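/- Let $E_4$ be a simple (embedded) open polygonal chain in $\mathbb{R}^3$ with vertices $p_0,\dots,p_4$ and edges $e_i=[p_{i-1},p_i]$ ($i=1,\dots,4$): all edges are non-degenerate, consecutive edges meet only in their common vertex, and other edges are disjoint. For a generic unit vector $\xi\in S^2$ let $(E_4)_\xi$ be the knotoid diagram obtained by projecting $E_4$ to the plane with normal vector $\xi$. For a knotoid diagram $K$ let $\langle K\rangle=\sum_S A^{\sigma(S)}(-A^2-A^{-2})^{\|S\|-1}$ be its bracket polynomial (sum over states) and $\mathrm{wr}(K)$ its writhe. The normalized bracket polynomial of $E_4$ is $$f(E_4)=\frac1{4\pi}\int_{S^2}(-A^3)^{-\mathrm{wr}((E_4)_\xi)}\langle (E_4)_\xi\rangle\,dS .$$ Let $\epsilon_{i,j}\in\{-1,0,1\}$ be the sign of the Gauss linking integral of $e_i,e_j$; when the projections of $e_i,e_j$ cross, it is the sign of the crossing. A diagram is said to be of type $k2.1$ if it represents in $S^2$ the knotoid $k2.1$ or one of its images under mirror reflection and under viewing the diagram from the other side of the projection plane. Probabilities $P$ are areas of sets of directions $\xi\in S^2$ divided by $4\pi$. Then $$f(E_4)=P(k2.1)\,(-A^3)^{-2\epsilon_{1,4}}\,\langle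 k2.1\rangle+\bigl(1-P(k2.1)\bigr),$$ where $P(k2.1)$ is the probability that $(E_4)_\xi$ is of type $k2.1$, and $\langle k2.1\rangle$ is the bracket polynomial of the standard two-crossing diagram of $k2.1$ with both crossings of sign $\epsilon_{1,4}$, namely $A^2+1-A^{-4}$ for the right-handed diagram (positive crossings) and $A^{-2}+1-A^{4}$ for the left-handed one (if $\epsilon_{1,4}=0$, then $P(k2.1)=0$). Moreover $P(k2.1)=P_{Bi}(E_4)+P_{Bii}(E_4)$. Here $P_{Bi}$ is the probability that the only crossings of $(E_4)_\xi$ are one of $e_1,e_3$ and one of $e_1,e_4$, of the same sign, met along the chain in the order $(13),(14),(13),(14)$, the passages being over, under, under, over or under, over, over, under. $P_{Bii}$ is the analogous probability for the crossings of $e_1,e_4$ and of $e_2,e_4$, met in the order $(14),(24),(14),(24)$. One has $P_{Bii}(E_4)=P_{Bi}(R(E_4))$, where $R(E_4)$ is the chain with reversed orientation, and, with $r_{ij}=p_i-p_j$, $$\begin{gathered}n_1=r_{02}\times r_{03},\quad n_2=r_{03}\times r_{13},\quad n_3=r_{13}\times r_{12},\quad n_4=r_{12}\times r_{02},\\ u_2=r_{04}\times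 r_{14},\quad v_2=r_{14}\times r_{24},\quad v_3=r_{24}\times r_{23},\\ w=(u_2\times(-n_2))\cdot(u_2\times n_4),\quad w_0=(v_3\times(-n_1))\cdot(v_3\times n_3),\quad c_{4,1}=\epsilon_{1,3}\,(p_1-p_4)\cdot n_1,\end{gathered}$$ $$P_{Bi}(E_4)=\begin{cases}0 & \text{if }\epsilon_{1,3}\ne\epsilon_{1,4}\text{ or } w\ge0\text{ or }w_0\ge0,\\ \frac1{2\pi}\mathrm{Area}(v_3,-v_2,-u_2)&\text{otherwise, if } c_{4,1}<0,\\ \frac1{2\pi}\mathrm{Area}(v_3,-v_2,n_1,-u_2)&\text{otherwise, if } c_{4,1}\ge0,\end{cases}$$ where $\mathrm{Area}(w_1,\dots,w_k)$ is the area of the spherical polygon $\{x\in S^2: x\cdot w_i\ge0\text{ for all }i\}$. The same closed form, applied to $R(E_4)$, gives $P_{Bii}(E_4)$. -/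

import Mathlib

open MeasureTheory LaurentPolynomial
open scoped RealInnerProductSpace

noncomputable section

/-! ### Knotoid diagrams on the sphere

A knotoid diagram in `S²` is recorded, up to isotopy of `S²`, by its signed Gauss code: travel
along the arc from its first to its last endpoint and write down, at every passage through a
crossing, the name of the crossing, whether one passes over, and the sign of the crossing. -/

/-- A passage of the arc through a crossing (`isOver`: on the upper strand; `positive`: the sign of the crossing). -/
structure Visit where
  label : ℕ
  isOver : Bool
  positive : Bool
  deriving DecidableEq

/-- The other passage through the same crossing. -/
def Visit.partner (v : Visit) : Visit := ⟨v.label, !v.isOver, v.positive⟩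

/-- Signed Gauss codes of open arcs. A code of length `m` cuts the arc into `m + 1` pieces
(`Fin (m + 1)`): the `i`-th passage leads from piece `i.castSucc` to piece `i.succ`. -/
abbrev GaussCode := List Visit

namespace GaussCode

/-- Every crossing occurs exactly twice, once over and once under, with the same sign. -/
def WellFormed (L : GaussCode) : Prop :=
  ∀ v ∈ L, (L.filter fun w => w.label = v.label).Perm [v, v.partner]

/-- `i` and `j` are the over- and the under-passage of one crossing. -/
def IsCrossing (L : GaussCode) (i j : Fin L.length) : Prop :=
  (L.get i).label = (L.get j).label ∧ (L.get i).isOver = true ∧ (L.get j).isOver = false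

/-- Sides `(piece, true)` (left) and `(piece, false)` (right) of the pieces of the arc that bound
the same region next to an endpoint of the arc or next to a crossing. -/
def SideGlue (L : GaussCode) (x y : Fin (L.length + 1) × Bool) : Prop :=
  (x.1 = y.1 ∧ (x.1 = 0 ∨ x.1 = Fin.last L.length)) ∨
  ∃ i j : Fin L.length, L.IsCrossing i j ∧
    if (L.get i).positive = true then
      (x = (i.succ, true) ∧ y = (j.succ, false)) ∨
      (x = (j.succ, true) ∧ y = (i.castSucc, true)) ∨
      (x = (i.castSucc, false) ∧ y = (j.castSucc, true)) ∨
      (x = (j.castSucc, false) ∧ y = (i.succ, false))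
    else
      (x = (i.succ, true) ∧ y = (j.castSucc, true)) ∨
      (x = (j.castSucc, false) ∧ y = (i.castSucc, true)) ∨
      (x = (i.castSucc, false) ∧ y = (j.succ, false)) ∨
      (x = (j.succ, true) ∧ y = (i.succ, false))

/-- The number of regions of the diagram on the closed oriented surface that the code determines. -/
def numFaces (L : GaussCode) : ℕ := Nat.card (Quot L.SideGlue)

/-- The code is the code of a knotoid diagram in `S²`. With `c` crossings there are `c + 2`
vertices and `2c + 1` edges, so the surface is a sphere if and only if there are `c + 1` regions. -/
def IsSpherical (L : GaussCode) : Prop :=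
  L.WellFormed ∧ 2 * L.numFaces = L.length + 2

/-- The three Reidemeister moves, away from the endpoints of the arc, and the renaming of
crossings.

In `r1` a kink is added. In `r2` two strands, parallel or antiparallel, are pushed across each
other. In `r3` the three strands of a triangle are a top strand with crossings `x` (with the middle
strand) and `y` (with the bottom strand), a middle strand with crossings `x` and `z`, and a bottom
strand with crossings `y` and `z`; `a`, `b`, `c` tell whether they are met in this order on the top,
the middle and the bottom strand. The two equations say that such orders and signs are those of
three straight lines in general position. The move reverses all three orders. -/
inductive Move : GaussCode → GaussCode → Prop
  | rename (σ : Equiv.Perm ℕ) (L : GaussCode) :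
      Move L (L.map fun v => ⟨σ v.label, v.isOver, v.positive⟩)
  | r1 (X Y : GaussCode) (c : ℕ) (o s : Bool) :
      Move (X ++ Y) (X ++ [⟨c, o, s⟩, ⟨c, !o, s⟩] ++ Y)
  | r2_parallel (X Y Z : GaussCode) (c d : ℕ) (o s : Bool) :
      Move (X ++ Y ++ Z)
        (X ++ [⟨c, o, s⟩, ⟨d, o, !s⟩] ++ Y ++ [⟨c, !o, s⟩, ⟨d, !o, !s⟩] ++ Z)
  | r2_antiparallel (X Y Z : GaussCode) (c d : ℕ) (o s : Bool) :
      Move (X ++ Y ++ Z)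
        (X ++ [⟨c, o, s⟩, ⟨d, o, !s⟩] ++ Y ++ [⟨d, !o, !s⟩, ⟨c, !o, s⟩] ++ Z)
  | r3 (W₀ W₁ W₂ W₃ P₁ P₂ P₃ : GaussCode) (x y z : ℕ) (sx sy sz a b c : Bool)
      (h₁ : (a == sy) = (b == sz)) (h₂ : (c == sy) = (b == sx))
      (h : [P₁, P₂, P₃].Perm
        [if a then [⟨x, true, sx⟩, ⟨y, true, sy⟩] else [⟨y, true, sy⟩, ⟨x, true, sx⟩],
         if b then [⟨x, false, sx⟩, ⟨z, true, sz⟩] else [⟨z, true, sz⟩, ⟨x, false, sx⟩],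
         if c then [⟨y, false, sy⟩, ⟨z, false, sz⟩] else [⟨z, false, sz⟩, ⟨y, false, sy⟩]]) :
      Move (W₀ ++ P₁ ++ W₁ ++ P₂ ++ W₂ ++ P₃ ++ W₃)
        (W₀ ++ P₁.reverse ++ W₁ ++ P₂.reverse ++ W₂ ++ P₃.reverse ++ W₃)

/-- Two diagrams in `S²` represent the same knotoid. -/
def Equivalent : GaussCode → GaussCode → Prop :=
  Relation.EqvGen fun L L' => L.IsSpherical ∧ L'.IsSpherical ∧ Move L L'

/-- The writhe: the sum of the signs of the crossings. -/
def writhe (L : GaussCode) : ℤ :=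
  ((L.filter fun v => v.isOver).map fun v => if v.positive then (1 : ℤ) else -1).sum

/-- The names of the crossings. -/
def labels (L : GaussCode) : Finset ℕ := (L.map Visit.label).toFinset

/-- The reconnections of pieces of the arc in the state in which the crossings in `S` receive their
`A`-smoothing and all others their `B`-smoothing. The smoothing that respects the orientation is the
`A`-smoothing of a positive and the `B`-smoothing of a negative crossing. -/
def StateGlue (L : GaussCode) (S : Finset ℕ) (x y : Fin (L.length + 1)) : Prop :=
  ∃ i j : Fin L.length, L.IsCrossing i j ∧
    if ((L.get i).label ∈ S ↔ (L.get i).positive = true) then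
      (x = i.castSucc ∧ y = j.succ) ∨ (x = j.castSucc ∧ y = i.succ)
    else
      (x = i.castSucc ∧ y = j.castSucc) ∨ (x = i.succ ∧ y = j.succ)

/-- The number `‖S‖` of components of a state. -/
def numComponents (L : GaussCode) (S : Finset ℕ) : ℕ := Nat.card (Quot (L.StateGlue S))

/-- The bracket polynomial `∑_S A^{σ(S)} d^{‖S‖-1}`, `d = -A² - A⁻²`; here `A` is `T 1`. -/
def bracket (L : GaussCode) : ℝ[T;T⁻¹] :=
  ∑ S ∈ L.labels.powerset,
    T ((S.card : ℤ) - ((L.labels \ S).card : ℤ)) * (-T 2 - T (-2)) ^ (L.numComponents S - 1)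

/-- `(-A³)^k`. -/
def negACubed (k : ℤ) : ℝ[T;T⁻¹] := C ((-1 : ℝ) ^ k) * T (3 * k)

/-- The normalized bracket polynomial `(-A³)^{-wr(K)} ⟨K⟩` of a diagram. -/
def normalizedBracket (L : GaussCode) : ℝ[T;T⁻¹] := negACubed (-L.writhe) * L.bracket

/-- The two-crossing diagrams in which the arc meets the crossings in the order `c, d, c, d`, both
of sign `s`, first over, under, under, over if `o` and first under, over, over, under if not. -/
def k21Diagram (c d : ℕ) (o s : Bool) : GaussCode :=
  [⟨c, o, s⟩, ⟨d, !o, s⟩, ⟨c, !o, s⟩, ⟨d, o, s⟩]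

/-- The standard diagrams of `k2.1`: the right-handed (`s = true`) one, its mirror image, and the
diagrams of both as seen from the other side of the projection plane (the other value of `o`). -/
def k21 (o s : Bool) : GaussCode := k21Diagram 0 1 o s

/-- The diagram is of knotoid type `k2.1` (as usual in tables, up to the symmetries just named). -/
def IsK21 (L : GaussCode) : Prop := ∃ o s : Bool, Equivalent L (k21 o s)

end GaussCode

/-! ### Polygonal chains and their projections -/

/-- Euclidean 3-space. -/
abbrev E3 := EuclideanSpace ℝ (Fin 3)

/-- The cross product. -/
def cross (x y : E3) : E3 := WithLp.toLp 2 (crossProduct x.ofLp y.ofLp)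

/-- The scalar triple product. -/
def triple (x y z : E3) : ℝ := ⟪cross x y, z⟫

namespace Chain

variable {n : ℕ}

/-- The `i`-th edge vector of the chain with vertices `p 0, …, p n`. -/
def edge (p : Fin (n + 1) → E3) (i : Fin n) : E3 := p i.succ - p i.castSucc

/-- The polygonal chain has no degenerate edge and does not meet itself: consecutive edges share
only their common vertex, other edges are disjoint. -/
structure IsSimple (p : Fin (n + 1) → E3) : Prop where
  edge_ne : ∀ i : Fin n, p i.castSucc ≠ p i.succ
  consecutive : ∀ i j : Fin n, (i : ℕ) + 1 = j →
    segment ℝ (p i.castSucc) (p i.succ) ∩ segment ℝ (p j.castSucc) (p j.succ) = {p j.castSucc}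
  disjoint : ∀ i j : Fin n, (i : ℕ) + 1 < j →
    Disjoint (segment ℝ (p i.castSucc) (p i.succ)) (segment ℝ (p j.castSucc) (p j.succ))

/-- The Gauss linking integral of the edges `i` and `j`. -/
def linking (p : Fin (n + 1) → E3) (i j : Fin n) : ℝ :=
  1 / (4 * Real.pi) * ∫ s in (0 : ℝ)..1, ∫ t in (0 : ℝ)..1,
    triple (edge p i) (edge p j) ((p i.castSucc + s • edge p i) - (p j.castSucc + t • edge p j)) /
      ‖(p i.castSucc + s • edge p i) - (p j.castSucc + t • edge p j)‖ ^ 3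

/-- The sign `ε` of the linking number of two edges. -/
def edgeSign (p : Fin (n + 1) → E3) (i j : Fin n) : SignType := SignType.sign (linking p i j)

/-- The parameter, along the edge `i`, of the point where the lines through the projections of the
edges `i` and `j` to the plane orthogonal to `ξ` meet (Cramer's rule; it is `0` if the projections
are parallel). -/
def crossParam (p : Fin (n + 1) → E3) (ξ : E3) (i j : Fin n) : ℝ :=
  triple (p j.castSucc - p i.castSucc) (edge p j) ξ / triple (edge p i) (edge p j) ξ

/-- The projections of the edges `i` and `j` cross. -/
def Crosses (p : Fin (n + 1) → E3) (ξ : E3) (i j : Fin n) : Prop :=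
  crossParam p ξ i j ∈ Set.Ioo (0 : ℝ) 1 ∧ crossParam p ξ j i ∈ Set.Ioo (0 : ℝ) 1

/-- The height, in direction `ξ`, of the point of the edge `i` above its crossing with `j`. -/
def height (p : Fin (n + 1) → E3) (ξ : E3) (i j : Fin n) : ℝ :=
  ⟪p i.castSucc + crossParam p ξ i j • edge p i, ξ⟫

/-- The name of the crossing of the edges `i` and `j`. -/
def crossingLabel (i j : Fin n) : ℕ := Nat.pair (min i j : Fin n) (max i j : Fin n)

open Classical in
/-- The passage of the edge `i` through its crossing with the edge `j`, seen from the side of the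
projection plane to which `ξ` points. -/
def visit (p : Fin (n + 1) → E3) (ξ : E3) (i j : Fin n) : Visit where
  label := crossingLabel i j
  isOver := decide (height p ξ j i < height p ξ i j)
  positive := decide (0 < if height p ξ j i < height p ξ i j
    then triple (edge p i) (edge p j) ξ else triple (edge p j) (edge p i) ξ)

open Classical in
/-- The diagram of the projection of the chain to the plane with normal vector `ξ`: all passages
through crossings in the order in which they occur along the chain. (For the null set of
non-generic `ξ` the value has no meaning.) -/
def diagram (p : Fin (n + 1) → E3) (ξ : E3) : GaussCode :=
  ((((List.finRange n).product (List.finRange n)).filter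
      fun x => Crosses p ξ x.1 x.2).insertionSort
    fun x y => (x.1 : ℝ) + crossParam p ξ x.1 x.2 ≤ (y.1 : ℝ) + crossParam p ξ y.1 y.2).map
      fun x => visit p ξ x.1 x.2

end Chain

/-! ### Averages over all projection directions -/

/-- The unit sphere. -/
abbrev Sphere2 := Metric.sphere (0 : E3) 1

/-- The area measure of the unit sphere. -/
def sphereArea : Measure Sphere2 := (volume : Measure E3).toSphere

/-- The probability that a random direction has the property `s`: its area divided by `4π`. -/
def directionProb (s : Set Sphere2) : ℝ := sphereArea.real s / (4 * Real.pi)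

/-- The area of the spherical polygon bounded by the great circles with normal vectors `ws`. -/
def polygonArea (ws : List E3) : ℝ := sphereArea.real {x : Sphere2 | ∀ w ∈ ws, 0 ≤ ⟪w, (x : E3)⟫}

namespace Chain

/-- `F` is the normalized bracket polynomial `f` of the chain: the average over all directions of
the normalized bracket polynomials of the projections, taken coefficient by coefficient. -/
def HasNormalizedBracket {n : ℕ} (p : Fin (n + 1) → E3) (F : ℝ[T;T⁻¹]) : Prop :=
  ∀ k : ℤ,
    Integrable (fun ξ : Sphere2 => (diagram p (ξ : E3)).normalizedBracket.coeff k) sphereArea ∧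
    F.coeff k = 1 / (4 * Real.pi) *
      ∫ ξ : Sphere2, (diagram p (ξ : E3)).normalizedBracket.coeff k ∂sphereArea

/-- The probability that a projection of the chain is of knotoid type `k2.1`. -/
def probK21 {n : ℕ} (p : Fin (n + 1) → E3) : ℝ :=
  directionProb {ξ | (diagram p (ξ : E3)).IsK21}

/-- The probability of the diagram `k2.1_{Bi}`: the edge `e₁` crosses `e₃` and then `e₄`, with the
same sign, and there are no other crossings. -/
def probBi (p : Fin 5 → E3) : ℝ :=
  directionProb {ξ | ∃ o s : Bool, diagram p (ξ : E3) =
    GaussCode.k21Diagram (crossingLabel (0 : Fin 4) 2) (crossingLabel (0 : Fin 4) 3) o s}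

/-- The probability of the diagram `k2.1_{Bii}`: the edge `e₄` crosses `e₁` and then `e₂`, with the
same sign, and there are no other crossings. -/
def probBii (p : Fin 5 → E3) : ℝ :=
  directionProb {ξ | ∃ o s : Bool, diagram p (ξ : E3) =
    GaussCode.k21Diagram (crossingLabel (0 : Fin 4) 3) (crossingLabel (1 : Fin 4) 3) o s}

/-- The chain with reversed orientation. -/
def reversed {n : ℕ} (p : Fin (n + 1) → E3) : Fin (n + 1) → E3 := fun i => p i.rev

/-- The closed form for the probability of `k2.1_{Bi}`. The vectors `n₁`, `n₂`, `n₃`, `n₄`, `u₂`,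
`v₂`, `v₃` are normal to the planes through the vertices `023`, `013`, `123`, `012`, `014`, `124`,
`234`; only their directions matter. -/
def closedFormBi (p : Fin 5 → E3) : ℝ :=
  let r : Fin 5 → Fin 5 → E3 := fun i j => p i - p j
  let n₁ := cross (r 0 2) (r 0 3)
  let n₂ := cross (r 0 3) (r 1 3)
  let n₃ := cross (r 1 3) (r 1 2)
  let n₄ := cross (r 1 2) (r 0 2)
  let u₂ := cross (r 0 4) (r 1 4)
  let v₂ := cross (r 1 4) (r 2 4)
  let v₃ := cross (r 2 4) (r 2 3)
  let w := ⟪cross u₂ (-n₂), cross u₂ n₄⟫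
  let w₀ := ⟪cross v₃ (-n₁), cross v₃ n₃⟫
  let c := ⟪p 1 - p 4, n₁⟫ * ((edgeSign p 0 2 : ℤ) : ℝ)
  open Classical in
  if edgeSign p 0 2 ≠ edgeSign p 0 3 ∨ 0 ≤ w ∨ 0 ≤ w₀ then 0
  else if c < 0 then 1 / (2 * Real.pi) * polygonArea [v₃, -v₂, -u₂]
  else 1 / (2 * Real.pi) * polygonArea [v₃, -v₂, n₁, -u₂]

end Chain

end

/-! Neighbouring edges never cross in projection, so only three pairs can: $e_1e_3$, $e_1e_4$ and
$e_2e_4$ (`Cr02`, `Cr03`, `Cr13`). The sign of a crossing does not depend on the direction: it is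
the sign of the volume `edgeVol` spanned by the two edges (`visit_eq`). This volume is also the
constant numerator of the Gauss integrand, so the sign equals $\epsilon_{i,j}$ (`edgeSign_eq`).
Which edge is on top is decided by the volume times the orientation of the two projected edges.
Hence the diagram can be read off from the signs of ten projected triangle areas and five
tetrahedron volumes, which satisfy linear and Plücker relations (`OrientedAreas`).

These relations leave few diagrams for almost every direction (`diagram_cases`). If $e_1e_3$ and
$e_2e_4$ both cross, then so does $e_1e_4$, the six passages have one fixed order, and the three
signs are not all equal (`not_all_pos`, `not_all_neg`); the normalized bracket is then 1. No
crossing, one crossing and two nested crossings also give 1. Two interleaved crossings lie on a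
common edge and have opposite orientations there: with opposite signs they form a bigon and the
normalized bracket is 1, with equal signs they form a diagram of `k2.1`. So the normalized bracket
takes only two values, and averaging gives the formula for $f$.

That the remaining diagrams are not `k2.1` needs an invariant. The odd writhe, a signed count of the
crossings whose passages are separated by an odd number of passages, is unchanged by all moves
(`Move.oddWrithe_eq`), nonzero for `k2.1` and zero for the others. Reversal of the chain exchanges
the two kinds of `k2.1` diagrams.

For the closed form, $w$ and $w_0$ are positive multiples of products of two volumes, and their
negativity is necessary for a diagram of kind Bi (`Bi.vol_signs`). When they are negative and
$\epsilon_{1,3}=\epsilon_{1,4}$, the relations show that, up to null sets, Bi holds exactly on the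
polygon and its antipode (`bi_iff_inPolygon`); this doubling turns $4\pi$ into $2\pi$. The side with
normal $n_1$ is redundant when $c_{4,1}<0$. -/

set_option linter.unusedSimpArgs false

/-! ### Counting the classes of a finite relation -/

namespace EdgeList

variable {α : Type*} [DecidableEq α]

/-- Replace `a` by `b`. -/
def redirect (a b x : α) : α := if x = a then b else x

/-- A representative of the class of a vertex in the graph with the listed edges: the edges are
contracted one after the other. -/
def repr : List (α × α) → ℕ → α → α
  | _, 0, x => x
  | [], _, x => x
  | (a, b) :: l, n + 1, x =>
      repr (l.map fun e => (redirect a b e.1, redirect a b e.2)) n (redirect a b x)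

/-- Contracting an edge identifies its ends, and every other edge survives in the contracted list,
so induction applies. The separate length argument makes `repr` structurally recursive, which lets
the kernel evaluate it. -/
theorem repr_eq_of_mem : ∀ (n : ℕ) (l : List (α × α)), l.length = n →
    ∀ u v, (u, v) ∈ l → repr l n u = repr l n v
  | 0, l, hn, u, v, h => by simp [List.length_eq_zero_iff.1 hn] at h
  | n + 1, [], hn, u, v, h => by simp at h
  | n + 1, (a, b) :: l, hn, u, v, h => by
    rcases List.mem_cons.1 h with h | h
    · obtain ⟨rfl, rfl⟩ := Prod.mk.inj h
      have : redirect u v u = redirect u v v := by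
        unfold redirect; split_ifs <;> simp_all
      simp only [repr, this]
    · refine repr_eq_of_mem n _ (by simpa using hn) _ _ ?_
      exact List.mem_map.2 ⟨(u, v), h, rfl⟩

theorem eqvGen_repr : ∀ (n : ℕ) (l : List (α × α)), l.length = n →
    ∀ x, Relation.EqvGen (fun u v => (u, v) ∈ l) x (repr l n x)
  | 0, l, hn, x => .refl _
  | n + 1, [], hn, x => .refl _
  | n + 1, (a, b) :: l, hn, x => by
    have step : ∀ y, Relation.EqvGen (fun u v => (u, v) ∈ (a, b) :: l) y (redirect a b y) := by
      intro y
      unfold redirect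
      split_ifs with h
      · exact .rel _ _ (by simp [h])
      · exact .refl _
    have key : ∀ y z, Relation.EqvGen (fun u v =>
        (u, v) ∈ l.map fun e => (redirect a b e.1, redirect a b e.2)) y z →
        Relation.EqvGen (fun u v => (u, v) ∈ (a, b) :: l) y z := by
      intro y z h
      induction h with
      | rel y z h =>
        obtain ⟨e, he, h⟩ := List.mem_map.1 h
        obtain ⟨rfl, rfl⟩ := Prod.mk.inj h
        exact (step e.1).symm.trans _ _ _ ((Relation.EqvGen.rel _ _
          (List.mem_cons_of_mem _ he)).trans _ _ _ (step e.2))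
      | refl => exact .refl _
      | symm _ _ _ ih => exact ih.symm
      | trans _ _ _ _ _ ih₁ ih₂ => exact ih₁.trans _ _ _ ih₂
    exact (step x).trans _ _ _ (key _ _ (eqvGen_repr n _ (by simpa using hn) _))

/-- The number of classes of the equivalence relation generated by the listed edges. -/
def numClasses [Fintype α] (l : List (α × α)) : ℕ := (Finset.univ.image (repr l l.length)).card

/-- The representative is constant on classes and lies in its own class, so it embeds the quotient
into `α`. Numbers of regions and of state components thereby become computable by `decide`. -/
theorem card_quot [Fintype α] {r : α → α → Prop} (l : List (α × α))
    (h : ∀ x y, r x y ↔ (x, y) ∈ l) : Nat.card (Quot r) = numClasses l := by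
  have hr : r = fun x y => (x, y) ∈ l := by
    ext x y; exact h x y
  subst hr
  let f : Quot (fun x y => (x, y) ∈ l) → α :=
    Quot.lift (repr l l.length) fun u v huv => repr_eq_of_mem _ l rfl u v huv
  have hf : Function.Injective f := by
    rintro ⟨x⟩ ⟨y⟩ hxy
    apply Quot.eqvGen_sound
    have hxy : repr l l.length x = repr l l.length y := hxy
    exact (eqvGen_repr _ l rfl x).trans _ _ _ (hxy ▸ (eqvGen_repr _ l rfl y).symm)
  rw [← Nat.card_range_of_injective hf]
  have : Set.range f = ((Finset.univ.image (repr l l.length) : Finset α) : Set α) := by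
    ext a
    constructor
    · rintro ⟨⟨x⟩, rfl⟩; simp [f]
    · intro ha
      obtain ⟨x, -, rfl⟩ := Finset.mem_image.1 (Finset.mem_coe.1 ha)
      exact ⟨Quot.mk _ x, rfl⟩
  rw [this, Nat.card_coe_set_eq, Set.ncard_coe_finset]
  rfl

end EdgeList

/-! ### Computing with Gauss codes -/

namespace GaussCode

instance (L : GaussCode) (i j : Fin L.length) : Decidable (L.IsCrossing i j) :=
  inferInstanceAs (Decidable (_ ∧ _ ∧ _))

instance (L : GaussCode) : Decidable L.WellFormed :=
  inferInstanceAs (Decidable (∀ v ∈ L, (L.filter fun w => w.label = v.label).Perm [v, v.partner]))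

/-- All pairs consisting of the over- and the under-passage of one crossing. -/
def crossings (L : GaussCode) : List (Fin L.length × Fin L.length) :=
  ((List.finRange L.length).product (List.finRange L.length)).filter fun q => L.IsCrossing q.1 q.2

theorem mem_crossings (L : GaussCode) (i j : Fin L.length) :
    (i, j) ∈ L.crossings ↔ L.IsCrossing i j := by
  simp [crossings]

/-- The reconnections in a state, as a list. -/
def stateEdges (L : GaussCode) (S : Finset ℕ) : List (Fin (L.length + 1) × Fin (L.length + 1)) :=
  L.crossings.flatMap fun q =>
    if ((L.get q.1).label ∈ S ↔ (L.get q.1).positive = true) then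
      [(q.1.castSucc, q.2.succ), (q.2.castSucc, q.1.succ)]
    else [(q.1.castSucc, q.2.castSucc), (q.1.succ, q.2.succ)]

theorem numComponents_eq (L : GaussCode) (S : Finset ℕ) :
    L.numComponents S = EdgeList.numClasses (L.stateEdges S) := by
  refine EdgeList.card_quot _ fun x y => ?_
  simp only [stateEdges, List.mem_flatMap, Prod.exists, mem_crossings]
  refine exists_congr fun i => exists_congr fun j => and_congr_right fun _ => ?_
  split_ifs <;> simp

/-- The pairs of sides bounding the same region, as a list. -/
def sideEdges (L : GaussCode) :
    List ((Fin (L.length + 1) × Bool) × (Fin (L.length + 1) × Bool)) :=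
  ([0, Fin.last L.length].flatMap fun e =>
    ([true, false].product [true, false]).map fun b => ((e, b.1), (e, b.2))) ++
  L.crossings.flatMap fun q =>
    if (L.get q.1).positive = true then
      [((q.1.succ, true), (q.2.succ, false)), ((q.2.succ, true), (q.1.castSucc, true)),
        ((q.1.castSucc, false), (q.2.castSucc, true)), ((q.2.castSucc, false), (q.1.succ, false))]
    else
      [((q.1.succ, true), (q.2.castSucc, true)), ((q.2.castSucc, false), (q.1.castSucc, true)),
        ((q.1.castSucc, false), (q.2.succ, false)), ((q.2.succ, true), (q.1.succ, false))]

theorem numFaces_eq (L : GaussCode) : L.numFaces = EdgeList.numClasses L.sideEdges := by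
  refine EdgeList.card_quot _ fun x y => ?_
  simp only [sideEdges, List.mem_append]
  refine or_congr ?_ ?_
  · obtain ⟨x, b⟩ := x
    obtain ⟨y, c⟩ := y
    cases b <;> cases c <;> simp [List.product] <;> constructor
    all_goals
      first
      | (rintro ⟨rfl, h⟩; exact h.imp (fun h => ⟨h, h⟩) (fun h => ⟨h, h⟩))
      | (rintro (⟨rfl, rfl⟩ | ⟨rfl, rfl⟩) <;> simp)
  · simp only [List.mem_flatMap, Prod.exists, mem_crossings]
    refine exists_congr fun i => exists_congr fun j => and_congr_right fun _ => ?_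
    split_ifs <;> simp

/-- The exponents of `A` and of `d` in the contributions of all states to the bracket polynomial. -/
def stateExponents (L : GaussCode) : Multiset (ℤ × ℕ) :=
  L.labels.powerset.val.map fun S =>
    ((S.card : ℤ) - ((L.labels \ S).card : ℤ), EdgeList.numClasses (L.stateEdges S) - 1)

theorem bracket_eq_sum (L : GaussCode) :
    L.bracket = (L.stateExponents.map fun q => T q.1 * (-T 2 - T (-2)) ^ q.2).sum := by
  simp only [bracket, stateExponents, Multiset.map_map, numComponents_eq]
  rfl

theorem normalizedBracket_eq {L : GaussCode} {w : ℤ} {l : List (ℤ × ℕ)} (hw : L.writhe = w)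
    (hl : L.stateExponents = l) : L.normalizedBracket =
      negACubed (-w) * (l.map fun q => T q.1 * (-T 2 - T (-2)) ^ q.2).sum := by
  rw [normalizedBracket, bracket_eq_sum, hw, hl]
  simp

end GaussCode

/-! ### The odd writhe -/

namespace GaussCode

/-- The sum of the values of `f` at all passages, with alternating signs. -/
def altSum (f : Visit → ℤ) : GaussCode → ℤ
  | [] => 0
  | v :: L => f v - altSum f L

@[simp] theorem altSum_nil (f : Visit → ℤ) : altSum f [] = 0 := rfl

@[simp] theorem altSum_cons (f : Visit → ℤ) (v : Visit) (L : GaussCode) :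
    altSum f (v :: L) = f v - altSum f L := rfl

theorem altSum_append (f : Visit → ℤ) (X Y : GaussCode) :
    altSum f (X ++ Y) = altSum f X + (-1) ^ X.length * altSum f Y := by
  induction X with
  | nil => simp
  | cons v X ih => simp [ih, pow_succ]; ring

theorem altSum_map (f : Visit → ℤ) (h : Visit → Visit) (L : GaussCode) :
    altSum f (L.map h) = altSum (fun v => f (h v)) L := by
  induction L with
  | nil => rfl
  | cons v L ih => simp [ih]

theorem altSum_eq_zero {f : Visit → ℤ} {L : GaussCode} (h : ∀ v ∈ L, f v = 0) :
    altSum f L = 0 := by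
  induction L with
  | nil => rfl
  | cons v L ih => simp_all

/-- `a` at the passages through the crossing `c`, and `0` elsewhere. -/
def atCrossing (c : ℕ) (a : Visit → ℤ) (v : Visit) : ℤ := if v.label = c then a v else 0

/-- The sign of the crossing as an integer. -/
def signOf (v : Visit) : ℤ := if v.positive then 1 else -1

/-- Four times the sign of a crossing if an odd number of passages separates its two passages, and
zero otherwise. -/
def oddIndex (L : GaussCode) (c : ℕ) : ℤ :=
  altSum (atCrossing c 1) L * altSum (atCrossing c signOf) L

/-- Four times the sum of the signs of the crossings whose two passages are separated by an odd
number of passages. -/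
def oddWrithe (L : GaussCode) : ℤ := ∑ c ∈ L.labels, L.oddIndex c

/-- The number of passages through a crossing. -/
def multiplicity (L : GaussCode) (c : ℕ) : ℕ := L.countP fun v => v.label = c

theorem altSum_eq_zero_of_multiplicity {L : GaussCode} {c : ℕ} (h : L.multiplicity c = 0)
    (a : Visit → ℤ) : altSum (atCrossing c a) L = 0 := by
  refine altSum_eq_zero fun v hv => ?_
  have := List.countP_eq_zero.1 h v hv
  simp_all [atCrossing]

theorem multiplicity_append (X Y : GaussCode) (c : ℕ) :
    (X ++ Y).multiplicity c = X.multiplicity c + Y.multiplicity c := List.countP_append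

theorem WellFormed.multiplicity_le {L : GaussCode} (h : L.WellFormed) (c : ℕ) :
    L.multiplicity c ≤ 2 := by
  by_cases hc : L.multiplicity c = 0
  · omega
  · obtain ⟨v, hv, hvc⟩ := List.countP_pos_iff.1 (Nat.pos_of_ne_zero hc)
    have := (h v hv).length_eq
    simp only [decide_eq_true_eq] at hvc
    simp [hvc] at this
    rw [multiplicity, List.countP_eq_length_filter, this]

/-- A label that does not occur has index zero; two diagrams can thus be compared over a common set
of labels. -/
theorem oddWrithe_eq_sum {L : GaussCode} {S : Finset ℕ} (h : L.labels ⊆ S) :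
    L.oddWrithe = ∑ c ∈ S, L.oddIndex c := by
  refine Finset.sum_subset h fun c _ hc => ?_
  have : L.multiplicity c = 0 := by
    refine List.countP_eq_zero.2 fun v hv hvc => hc ?_
    simp only [decide_eq_true_eq] at hvc
    exact List.mem_toFinset.2 (List.mem_map.2 ⟨v, hv, hvc⟩)
  rw [oddIndex, altSum_eq_zero_of_multiplicity this, zero_mul]

theorem oddWrithe_congr {L L' : GaussCode} (h : ∀ c, L.oddIndex c = L'.oddIndex c) :
    L.oddWrithe = L'.oddWrithe := by
  rw [oddWrithe_eq_sum (Finset.subset_union_left (s₂ := L'.labels)),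
    oddWrithe_eq_sum (Finset.subset_union_right (s₁ := L.labels))]
  exact Finset.sum_congr rfl fun c _ => h c

theorem oddWrithe_congr_pair {L L' : GaussCode} {c d : ℕ} (hcd : c ≠ d)
    (h : ∀ e, e ≠ c → e ≠ d → L.oddIndex e = L'.oddIndex e)
    (h' : L.oddIndex c + L.oddIndex d = L'.oddIndex c + L'.oddIndex d) :
    L.oddWrithe = L'.oddWrithe := by
  set S := L.labels ∪ L'.labels ∪ {c, d}
  rw [oddWrithe_eq_sum (S := S) fun x hx => by simp [S, hx],
    oddWrithe_eq_sum (L := L') (S := S) fun x hx => by simp [S, hx], ← sub_eq_zero,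
    ← Finset.sum_sub_distrib, ← Finset.sum_subset (s₁ := {c, d}) (fun x hx => by
      simp only [S, Finset.mem_union]; exact Or.inr hx) fun x _ hx => by
      simp only [Finset.mem_insert, Finset.mem_singleton, not_or] at hx
      rw [h x hx.1 hx.2, sub_self], Finset.sum_pair hcd]
  linarith

theorem oddWrithe_rename (σ : Equiv.Perm ℕ) (L : GaussCode) :
    oddWrithe (L.map fun v => ⟨σ v.label, v.isOver, v.positive⟩) = L.oddWrithe := by
  have hl : labels (L.map fun v => ⟨σ v.label, v.isOver, v.positive⟩) =
      L.labels.map σ.toEmbedding := by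
    ext c; simp [labels, Equiv.eq_symm_apply]
  rw [oddWrithe, hl, Finset.sum_map]
  refine Finset.sum_congr rfl fun c _ => ?_
  simp only [oddIndex, altSum_map]
  congr 2 <;> funext v <;> simp [atCrossing, signOf]

/-- The two new passages are adjacent and carry the same sign, so they cancel in every alternating
sum, even if the label is already in use. -/
theorem oddWrithe_r1 (X Y : GaussCode) (c : ℕ) (o s : Bool) :
    oddWrithe (X ++ Y) = oddWrithe (X ++ [⟨c, o, s⟩, ⟨c, !o, s⟩] ++ Y) := by
  refine oddWrithe_congr fun e => ?_
  simp [oddIndex, altSum_append, atCrossing, signOf]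

/-- Blocks of length two preserve the parity of all other positions. The two new crossings have
passages separated by numbers of the same parity and have opposite signs, so their indices cancel.
-/
theorem oddWrithe_r2 (X Y Z P : GaussCode) (c d : ℕ) (o s : Bool)
    (hP : P = [⟨c, !o, s⟩, ⟨d, !o, !s⟩] ∨ P = [⟨d, !o, !s⟩, ⟨c, !o, s⟩])
    (h : WellFormed (X ++ [⟨c, o, s⟩, ⟨d, o, !s⟩] ++ Y ++ P ++ Z)) :
    oddWrithe (X ++ Y ++ Z) = oddWrithe (X ++ [⟨c, o, s⟩, ⟨d, o, !s⟩] ++ Y ++ P ++ Z) := by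
  have hc := h.multiplicity_le c
  have hd := h.multiplicity_le d
  have hl : P.length = 2 := by rcases hP with rfl | rfl <;> rfl
  have hcd : c ≠ d := by
    rintro rfl
    rcases hP with rfl | rfl <;> simp only [multiplicity_append] at hc <;>
      simp [multiplicity] at hc <;> omega
  -- The inserted blocks already contain the two passages that well-formedness allows for each of
  -- these labels.
  have zero : ∀ e, e = c ∨ e = d →
      X.multiplicity e = 0 ∧ Y.multiplicity e = 0 ∧ Z.multiplicity e = 0 := by
    rintro e (rfl | rfl) <;> rcases hP with rfl | rfl <;>
      simp only [multiplicity_append] at hc hd <;>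
      simp [multiplicity, hcd, hcd.symm] at hc hd <;> simp only [multiplicity] <;> omega
  obtain ⟨c₁, c₂, c₃⟩ := zero c (.inl rfl)
  obtain ⟨d₁, d₂, d₃⟩ := zero d (.inr rfl)
  refine oddWrithe_congr_pair hcd (fun e he he' => ?_) ?_
  · have : ∀ a, altSum (atCrossing e a) P = 0 := by
      intro a
      rcases hP with rfl | rfl <;> simp [atCrossing, he.symm, he'.symm]
    simp [oddIndex, altSum_append, this, hl, atCrossing, he.symm, he'.symm]
  · simp only [oddIndex, altSum_append, altSum_eq_zero_of_multiplicity, c₁, c₂, c₃, d₁, d₂, d₃]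
    rcases hP with rfl | rfl <;> simp [atCrossing, hcd, hcd.symm, signOf, pow_add] <;>
      cases s <;> simp <;> ring

theorem altSum_reverse_of_length {P : GaussCode} (h : P.length = 2) (f : Visit → ℤ) :
    altSum f P.reverse = -altSum f P := by
  obtain ⟨u, v, rfl⟩ := List.length_eq_two.1 h
  simp

/-- Reversing the blocks moves each passage of the triangle by one place. Both alternating sums of
such a crossing change sign and their product does not; all other positions keep their parity. -/
theorem oddWrithe_r3 (W₀ W₁ W₂ W₃ P₁ P₂ P₃ : GaussCode) (h₁ : P₁.length = 2)
    (h₂ : P₂.length = 2) (h₃ : P₃.length = 2)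
    (h : ∀ c, (W₀.multiplicity c = 0 ∧ W₁.multiplicity c = 0 ∧ W₂.multiplicity c = 0 ∧
      W₃.multiplicity c = 0) ∨
      (P₁.multiplicity c = 0 ∧ P₂.multiplicity c = 0 ∧ P₃.multiplicity c = 0)) :
    oddWrithe (W₀ ++ P₁ ++ W₁ ++ P₂ ++ W₂ ++ P₃ ++ W₃) =
      oddWrithe (W₀ ++ P₁.reverse ++ W₁ ++ P₂.reverse ++ W₂ ++ P₃.reverse ++ W₃) := by
  refine oddWrithe_congr fun c => ?_
  rcases h c with ⟨w₀, w₁, w₂, w₃⟩ | ⟨p₁, p₂, p₃⟩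
  · simp [oddIndex, altSum_append, altSum_eq_zero_of_multiplicity, w₀, w₁, w₂, w₃,
      altSum_reverse_of_length, h₁, h₂, h₃]
    ring
  · simp [oddIndex, altSum_append, altSum_eq_zero_of_multiplicity, p₁, p₂, p₃,
      altSum_reverse_of_length, h₁, h₂, h₃]

theorem Move.oddWrithe_eq {L L' : GaussCode} (h : Move L L') (hL : L.WellFormed)
    (hL' : L'.WellFormed) : L.oddWrithe = L'.oddWrithe := by
  cases h with
  | rename σ L => exact (oddWrithe_rename σ L).symm
  | r1 X Y c o s => exact oddWrithe_r1 X Y c o s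
  | r2_parallel X Y Z c d o s => exact oddWrithe_r2 X Y Z _ c d o s (.inl rfl) hL'
  | r2_antiparallel X Y Z c d o s => exact oddWrithe_r2 X Y Z _ c d o s (.inr rfl) hL'
  | r3 W₀ W₁ W₂ W₃ P₁ P₂ P₃ x y z sx sy sz a b c _ _ hP =>
    have hlen : ∀ P ∈ [P₁, P₂, P₃], P.length = 2 := by
      intro P hmem
      have := hP.mem_iff.1 hmem
      simp only [List.mem_cons, List.not_mem_nil, or_false] at this
      rcases this with rfl | rfl | rfl <;> split_ifs <;> rfl
    refine oddWrithe_r3 _ _ _ _ _ _ _ (hlen _ (by simp)) (hlen _ (by simp)) (hlen _ (by simp))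
      fun e => ?_
    have hsum := ((hP.map fun P => multiplicity P e).sum_eq)
    simp only [List.map_cons, List.map_nil, List.sum_cons, List.sum_nil, add_zero] at hsum
    have he := hL.multiplicity_le e
    simp only [multiplicity_append] at he
    -- Both passages of a crossing of the triangle lie in the three blocks, so none is left for the
    -- remaining words.
    by_cases hxyz : x = e ∨ y = e ∨ z = e
    · left
      have : 2 ≤ multiplicity P₁ e + (multiplicity P₂ e + multiplicity P₃ e) := by
        rw [hsum]
        rcases hxyz with rfl | rfl | rfl <;> cases a <;> cases b <;> cases c <;>
          simp [multiplicity, List.countP_cons] <;> omega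
      omega
    · right
      simp only [not_or] at hxyz
      have : multiplicity P₁ e + (multiplicity P₂ e + multiplicity P₃ e) = 0 := by
        rw [hsum]
        cases a <;> cases b <;> cases c <;> simp [multiplicity, hxyz]
      omega

theorem Equivalent.oddWrithe_eq {L L' : GaussCode} (h : Equivalent L L') :
    L.oddWrithe = L'.oddWrithe := by
  induction h with
  | rel L L' h => exact h.2.2.oddWrithe_eq h.1.1 h.2.1.1
  | refl => rfl
  | symm _ _ _ ih => exact ih.symm
  | trans _ _ _ _ _ ih₁ ih₂ => exact ih₁.trans ih₂

/-- In a standard diagram one passage separates the two passages of each crossing, and the signs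
agree: the value is 8 or -8. -/
theorem IsK21.oddWrithe_ne_zero {L : GaussCode} (h : L.IsK21) : L.oddWrithe ≠ 0 := by
  obtain ⟨o, s, h⟩ := h
  rw [h.oddWrithe_eq]
  clear h
  revert o s
  decide +kernel

end GaussCode

/-! ### The diagrams of chains with four edges -/

namespace GaussCode

/-- The other passage, listed with a passage. -/
def kink (v : Visit) : GaussCode := [v, v.partner]

/-- Two nested crossings. -/
def nested (v w : Visit) : GaussCode := [v, w, w.partner, v.partner]

/-- Two interleaved crossings. -/
def interleaved (v w : Visit) : GaussCode := [v, w, v.partner, w.partner]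

/-- Three mutually interleaved crossings. -/
def interleaved₃ (u v w : Visit) : GaussCode := [u, v, w, u.partner, v.partner, w.partner]

/-! ### Normalized bracket polynomials of the diagrams that occur -/

theorem negACubed_neg_mul {k : ℤ} {f : ℝ[T;T⁻¹]} (hf : f = negACubed k) :
    negACubed (-k) * f = 1 := by
  subst hf
  rw [negACubed, negACubed, show ∀ a b c d : ℝ[T;T⁻¹], a * b * (c * d) = a * c * (b * d) by
    intros; ring, ← map_mul, ← T_add, ← zpow_add₀ (by norm_num), neg_add_cancel,
    show 3 * -k + 3 * k = 0 by ring]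
  simp

theorem normalizedBracket_eq_one {L : GaussCode} {w : ℤ} {l : List (ℤ × ℕ)} (hw : L.writhe = w)
    (hl : L.stateExponents = l)
    (h : (l.map fun q => (T q.1 * (-T 2 - T (-2)) ^ q.2 : ℝ[T;T⁻¹])).sum = negACubed w) :
    L.normalizedBracket = 1 := by
  rw [normalizedBracket_eq hw hl, negACubed_neg_mul h]

theorem normalizedBracket_nil : normalizedBracket [] = 1 := by
  refine normalizedBracket_eq_one (w := 0) (l := [(0, 0)]) rfl (by decide +kernel) ?_
  simp [negACubed]

/-- The labels 4, 9 and 10 are `Nat.pair 0 2`, `Nat.pair 0 3` and `Nat.pair 1 3`, the names of the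
three possible crossings. The state sum sees the positions and signs of the crossings but not which
strand is on top, so one list of exponents serves all values of `o`. -/
theorem normalizedBracket_kink {c : ℕ} (hc : c ∈ [4, 9, 10]) (o s : Bool) :
    normalizedBracket (kink ⟨c, o, s⟩) = 1 := by
  cases s
  · refine normalizedBracket_eq_one (w := -1) (l := [(-1, 1), (1, 0)])
      (by revert c o; decide +kernel) (by revert c o; decide +kernel) ?_
    simp only [List.map_cons, List.map_nil, List.sum_cons, List.sum_nil, Multiset.map_coe,
      Multiset.sum_coe, negACubed, pow_succ, pow_zero, one_mul, mul_one, add_zero,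
      sub_mul, mul_sub, neg_mul, mul_neg, ← T_add]
    norm_num [T_zero]
    try ring
  · refine normalizedBracket_eq_one (w := 1) (l := [(-1, 0), (1, 1)])
      (by revert c o; decide +kernel) (by revert c o; decide +kernel) ?_
    simp only [List.map_cons, List.map_nil, List.sum_cons, List.sum_nil, Multiset.map_coe,
      Multiset.sum_coe, negACubed, pow_succ, pow_zero, one_mul, mul_one, add_zero,
      sub_mul, mul_sub, neg_mul, mul_neg, ← T_add]
    norm_num [T_zero]
    try ring

theorem normalizedBracket_nested {e : ℕ × ℕ} (he : e ∈ [(9, 4), (9, 10)]) (o o' s s' : Bool) :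
    normalizedBracket (nested ⟨e.1, o, s⟩ ⟨e.2, o', s'⟩) = 1 := by
  cases s <;> cases s'
  · refine normalizedBracket_eq_one (w := -2) (l := [(-2, 2), (0, 1), (0, 1), (2, 0)])
      (by revert e o o'; decide +kernel) (by revert e o o'; decide +kernel) ?_
    simp only [List.map_cons, List.map_nil, List.sum_cons, List.sum_nil, Multiset.map_coe,
      Multiset.sum_coe, negACubed, pow_succ, pow_zero, one_mul, mul_one, add_zero,
      sub_mul, mul_sub, neg_mul, mul_neg, ← T_add]
    norm_num [T_zero]
    try ring
  · refine normalizedBracket_eq_one (w := 0) (l := [(-2, 1), (0, 2), (0, 0), (2, 1)])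
      (by revert e o o'; decide +kernel) (by revert e o o'; decide +kernel) ?_
    simp only [List.map_cons, List.map_nil, List.sum_cons, List.sum_nil, Multiset.map_coe,
      Multiset.sum_coe, negACubed, pow_succ, pow_zero, one_mul, mul_one, add_zero,
      sub_mul, mul_sub, neg_mul, mul_neg, ← T_add]
    norm_num [T_zero]
    try ring
  · refine normalizedBracket_eq_one (w := 0) (l := [(-2, 1), (0, 0), (0, 2), (2, 1)])
      (by revert e o o'; decide +kernel) (by revert e o o'; decide +kernel) ?_
    simp only [List.map_cons, List.map_nil, List.sum_cons, List.sum_nil, Multiset.map_coe,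
      Multiset.sum_coe, negACubed, pow_succ, pow_zero, one_mul, mul_one, add_zero,
      sub_mul, mul_sub, neg_mul, mul_neg, ← T_add]
    norm_num [T_zero]
    try ring
  · refine normalizedBracket_eq_one (w := 2) (l := [(-2, 0), (0, 1), (0, 1), (2, 2)])
      (by revert e o o'; decide +kernel) (by revert e o o'; decide +kernel) ?_
    simp only [List.map_cons, List.map_nil, List.sum_cons, List.sum_nil, Multiset.map_coe,
      Multiset.sum_coe, negACubed, pow_succ, pow_zero, one_mul, mul_one, add_zero,
      sub_mul, mul_sub, neg_mul, mul_neg, ← T_add]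
    norm_num [T_zero]
    try ring

/-- This is the pattern that `r2_parallel` creates on the trivial arc. -/
theorem normalizedBracket_interleaved {e : ℕ × ℕ} (he : e ∈ [(4, 9), (9, 10)]) (o s : Bool) :
    normalizedBracket (interleaved ⟨e.1, o, s⟩ ⟨e.2, o, !s⟩) = 1 := by
  refine normalizedBracket_eq_one (w := 0) (l := [(-2, 0), (0, 0), (0, 1), (2, 0)])
    (by revert e o s; decide +kernel) (by revert e o s; decide +kernel) ?_
  simp only [List.map_cons, List.map_nil, List.sum_cons, List.sum_nil, Multiset.map_coe,
    Multiset.sum_coe, negACubed, pow_succ, pow_zero, one_mul, mul_one, add_zero,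
    sub_mul, mul_sub, neg_mul, mul_neg, ← T_add]
  norm_num [T_zero]
  try ring

theorem normalizedBracket_interleaved₃ (o₁ o₂ o₃ s₁ s₂ s₃ : Bool)
    (hs : ¬(s₁ = s₂ ∧ s₂ = s₃)) :
    normalizedBracket (interleaved₃ ⟨4, o₁, s₁⟩ ⟨9, o₂, s₂⟩ ⟨10, o₃, s₃⟩) = 1 := by
  -- As the signs are not all equal, the writhe is -1 if exactly one crossing is positive, and 1
  -- otherwise.
  cases hc : (s₁.toNat + s₂.toNat + s₃.toNat == 1)
  · refine normalizedBracket_eq_one (w := 1)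
      (l := [(-3, 1), (-1, 0), (-1, 2), (1, 1), (-1, 0), (1, 1), (1, 1), (3, 0)])
      (by revert o₁ o₂ o₃ s₁ s₂ s₃; decide +kernel)
      (by revert o₁ o₂ o₃ s₁ s₂ s₃; decide +kernel) ?_
    simp only [List.map_cons, List.map_nil, List.sum_cons, List.sum_nil, Multiset.map_coe,
      Multiset.sum_coe, negACubed, pow_succ, pow_zero, one_mul, mul_one, add_zero,
      sub_mul, mul_sub, neg_mul, mul_neg, ← T_add]
    norm_num [T_zero]
    try ring
  · refine normalizedBracket_eq_one (w := -1)
      (l := [(-3, 0), (-1, 1), (-1, 1), (1, 0), (-1, 1), (1, 0), (1, 2), (3, 1)])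
      (by revert o₁ o₂ o₃ s₁ s₂ s₃; decide +kernel)
      (by revert o₁ o₂ o₃ s₁ s₂ s₃; decide +kernel) ?_
    simp only [List.map_cons, List.map_nil, List.sum_cons, List.sum_nil, Multiset.map_coe,
      Multiset.sum_coe, negACubed, pow_succ, pow_zero, one_mul, mul_one, add_zero,
      sub_mul, mul_sub, neg_mul, mul_neg, ← T_add]
    norm_num [T_zero]
    try ring

theorem bracket_k21Diagram_true {e : ℕ × ℕ} (he : e ∈ [(0, 1), (4, 9), (9, 10)]) (o : Bool) :
    bracket (k21Diagram e.1 e.2 o true) = T 2 + 1 - T (-4) := by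
  rw [bracket_eq_sum, show stateExponents (k21Diagram e.1 e.2 o true) =
    ↑[((-2 : ℤ), 1), (0, 0), (0, 0), (2, 0)] by revert e o; decide +kernel]
  simp only [List.map_cons, List.map_nil, List.sum_cons, List.sum_nil, Multiset.map_coe,
    Multiset.sum_coe, negACubed, pow_succ, pow_zero, one_mul, mul_one, add_zero,
    sub_mul, mul_sub, neg_mul, mul_neg, ← T_add]
  norm_num [T_zero]
  try ring

theorem bracket_k21Diagram_false {e : ℕ × ℕ} (he : e ∈ [(0, 1), (4, 9), (9, 10)]) (o : Bool) :
    bracket (k21Diagram e.1 e.2 o false) = T (-2) + 1 - T 4 := by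
  rw [bracket_eq_sum, show stateExponents (k21Diagram e.1 e.2 o false) =
    ↑[((-2 : ℤ), 0), (0, 0), (0, 0), (2, 1)] by revert e o; decide +kernel]
  simp only [List.map_cons, List.map_nil, List.sum_cons, List.sum_nil, Multiset.map_coe,
    Multiset.sum_coe, negACubed, pow_succ, pow_zero, one_mul, mul_one, add_zero,
    sub_mul, mul_sub, neg_mul, mul_neg, ← T_add]
  norm_num [T_zero]
  try ring

theorem normalizedBracket_k21Diagram {e : ℕ × ℕ} (he : e ∈ [(4, 9), (9, 10)])
    (o o' s : Bool) : normalizedBracket (k21Diagram e.1 e.2 o s) =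
      negACubed (-2 * (if s then 1 else -1)) * bracket (k21 o' s) := by
  have hw : writhe (k21Diagram e.1 e.2 o s) = 2 * (if s then 1 else -1) := by
    revert e o s; decide +kernel
  have he' : e ∈ [(0, 1), (4, 9), (9, 10)] := List.mem_cons_of_mem _ he
  rw [normalizedBracket, hw, neg_mul]
  congr 1
  cases s
  · rw [bracket_k21Diagram_false he', k21, bracket_k21Diagram_false (e := (0, 1)) (by simp)]
  · rw [bracket_k21Diagram_true he', k21, bracket_k21Diagram_true (e := (0, 1)) (by simp)]

theorem isSpherical_k21Diagram {e : ℕ × ℕ} (he : e ∈ [(0, 1), (4, 9), (9, 10)])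
    (o s : Bool) : IsSpherical (k21Diagram e.1 e.2 o s) := by
  refine ⟨by revert e o s; decide +kernel, ?_⟩
  rw [numFaces_eq]
  revert e o s
  decide +kernel

theorem isK21_k21Diagram {e : ℕ × ℕ} (he : e ∈ [(4, 9), (9, 10)]) (o s : Bool) :
    IsK21 (k21Diagram e.1 e.2 o s) := by
  refine ⟨o, s, .symm _ _ (.rel _ _ ⟨isSpherical_k21Diagram (e := (0, 1)) (by simp) o s,
    isSpherical_k21Diagram (List.mem_cons_of_mem _ he) o s, ?_⟩)⟩
  obtain ⟨σ, h₀, h₁⟩ : ∃ σ : Equiv.Perm ℕ, σ 0 = e.1 ∧ σ 1 = e.2 := by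
    simp only [List.mem_cons, List.not_mem_nil, or_false] at he
    rcases he with rfl | rfl
    · exact ⟨Equiv.swap 0 4 * Equiv.swap 1 9, by decide, by decide⟩
    · exact ⟨Equiv.swap 0 9 * Equiv.swap 1 10, by decide, by decide⟩
  have := Move.rename σ (k21 o s)
  simpa [k21, k21Diagram, h₀, h₁] using this

/-! ### Odd writhes of the diagrams that occur -/

theorem oddWrithe_nil : oddWrithe [] = 0 := rfl

theorem oddWrithe_kink {c : ℕ} (hc : c ∈ [4, 9, 10]) (o s : Bool) :
    oddWrithe (kink ⟨c, o, s⟩) = 0 := by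
  revert c o s; decide +kernel

theorem oddWrithe_nested {e : ℕ × ℕ} (he : e ∈ [(9, 4), (9, 10)]) (o o' s s' : Bool) :
    oddWrithe (nested ⟨e.1, o, s⟩ ⟨e.2, o', s'⟩) = 0 := by
  revert e o o' s s'; decide +kernel

theorem oddWrithe_interleaved {e : ℕ × ℕ} (he : e ∈ [(4, 9), (9, 10)]) (o s : Bool) :
    oddWrithe (interleaved ⟨e.1, o, s⟩ ⟨e.2, o, !s⟩) = 0 := by
  revert e o s; decide +kernel

theorem oddWrithe_interleaved₃ (o₁ o₂ o₃ s₁ s₂ s₃ : Bool) :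
    oddWrithe (interleaved₃ ⟨4, o₁, s₁⟩ ⟨9, o₂, s₂⟩ ⟨10, o₃, s₃⟩) = 0 := by
  revert o₁ o₂ o₃ s₁ s₂ s₃; decide +kernel

end GaussCode

/-! ### Orientations of five points in space and of their projections -/

/-- The oriented areas `t` of the triangles and the oriented volumes `v` of the tetrahedra spanned by
five points in space and their projections to a plane, with the relations between them; `v k`
belongs to the tetrahedron of all points but the `k`-th. -/
structure OrientedAreas where
  (t012 t013 t014 t023 t024 t034 t123 t124 t134 t234 v0 v1 v2 v3 v4 : ℝ)
  lin0 : t234 - t134 + t124 - t123 = 0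
  lin1 : t234 - t034 + t024 - t023 = 0
  lin2 : t134 - t034 + t014 - t013 = 0
  lin3 : t124 - t024 + t014 - t012 = 0
  lin4 : t123 - t023 + t013 - t012 = 0
  quad0 : t012 * t034 - t013 * t024 + t014 * t023 = 0
  quad1 : t012 * t134 - t013 * t124 + t014 * t123 = 0
  quad2 : t012 * t234 - t023 * t124 + t024 * t123 = 0
  quad3 : t013 * t234 - t023 * t134 + t034 * t123 = 0
  quad4 : t014 * t234 - t024 * t134 + t034 * t124 = 0
  edge01 : v4 * t014 - v3 * t013 + v2 * t012 = 0
  edge02 : v4 * t024 - v3 * t023 + v1 * t012 = 0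
  edge03 : v4 * t034 - v2 * t023 + v1 * t013 = 0
  edge12 : v4 * t124 - v3 * t123 + v0 * t012 = 0
  edge14 : v3 * t134 - v2 * t124 + v0 * t014 = 0
  edge23 : v4 * t234 - v1 * t123 + v0 * t023 = 0
  edge24 : v3 * t234 - v1 * t124 + v0 * t024 = 0
  edge34 : v2 * t234 - v1 * t134 + v0 * t034 = 0
  vol : v0 - v1 + v2 - v3 + v4 = 0

namespace OrientedAreas

/-- The projections seen from the other side of the plane. -/
def neg (C : OrientedAreas) : OrientedAreas where
  t012 := -C.t012
  t013 := -C.t013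
  t014 := -C.t014
  t023 := -C.t023
  t024 := -C.t024
  t034 := -C.t034
  t123 := -C.t123
  t124 := -C.t124
  t134 := -C.t134
  t234 := -C.t234
  v0 := C.v0
  v1 := C.v1
  v2 := C.v2
  v3 := C.v3
  v4 := C.v4
  lin0 := by linear_combination -C.lin0
  lin1 := by linear_combination -C.lin1
  lin2 := by linear_combination -C.lin2
  lin3 := by linear_combination -C.lin3
  lin4 := by linear_combination -C.lin4
  quad0 := by linear_combination C.quad0
  quad1 := by linear_combination C.quad1
  quad2 := by linear_combination C.quad2
  quad3 := by linear_combination C.quad3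
  quad4 := by linear_combination C.quad4
  edge01 := by linear_combination -C.edge01
  edge02 := by linear_combination -C.edge02
  edge03 := by linear_combination -C.edge03
  edge12 := by linear_combination -C.edge12
  edge14 := by linear_combination -C.edge14
  edge23 := by linear_combination -C.edge23
  edge24 := by linear_combination -C.edge24
  edge34 := by linear_combination -C.edge34
  vol := C.vol

/-- The mirror image with respect to the plane. -/
def mirror (C : OrientedAreas) : OrientedAreas where
  __ := C
  v0 := -C.v0
  v1 := -C.v1
  v2 := -C.v2
  v3 := -C.v3
  v4 := -C.v4
  edge01 := by linear_combination -C.edge01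
  edge02 := by linear_combination -C.edge02
  edge03 := by linear_combination -C.edge03
  edge12 := by linear_combination -C.edge12
  edge14 := by linear_combination -C.edge14
  edge23 := by linear_combination -C.edge23
  edge24 := by linear_combination -C.edge24
  edge34 := by linear_combination -C.edge34
  vol := by linear_combination -C.vol

variable (C : OrientedAreas)

/-- The segments `01` and `23` cross. -/
def Cr02 : Prop := C.t012 * C.t013 < 0 ∧ C.t023 * C.t123 < 0

/-- The segments `01` and `34` cross. -/
def Cr03 : Prop := C.t013 * C.t014 < 0 ∧ C.t034 * C.t134 < 0

/-- The segments `12` and `34` cross. -/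
def Cr13 : Prop := C.t123 * C.t124 < 0 ∧ C.t134 * C.t234 < 0

theorem cr02_neg : C.neg.Cr02 ↔ C.Cr02 := by simp [Cr02, neg]
theorem cr03_neg : C.neg.Cr03 ↔ C.Cr03 := by simp [Cr03, neg]
theorem cr13_neg : C.neg.Cr13 ↔ C.Cr13 := by simp [Cr13, neg]

variable {C}

theorem _root_.neg_pos_of_mul_neg {a b c : ℝ} (h : a * b < 0) (hc : 0 < c) (hab : b - a = c) :
    a < 0 ∧ 0 < b := by
  rcases mul_neg_iff.1 h with ⟨h₁, h₂⟩ | h'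
  · linarith
  · exact h'

/-- By `lin4` the difference of the second pair of areas equals the difference of the first pair, so
a single sign determines all four. -/
theorem Cr02.signs (h : C.Cr02) (h0 : 0 < C.t012) : C.t013 < 0 ∧ C.t023 < 0 ∧ 0 < C.t123 := by
  have h1 : C.t013 < 0 := neg_of_mul_neg_right h.1 h0.le
  obtain ⟨h2, h3⟩ := neg_pos_of_mul_neg h.2 (c := C.t012 - C.t013) (by linarith)
    (by linear_combination C.lin4)
  exact ⟨h1, h2, h3⟩

theorem Cr03.signs (h : C.Cr03) (h0 : C.t013 < 0) : 0 < C.t014 ∧ 0 < C.t034 ∧ C.t134 < 0 := by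
  have h1 : 0 < C.t014 := (neg_pos_of_mul_neg h.1 (c := C.t014 - C.t013) (by
    rcases mul_neg_iff.1 h.1 with ⟨h₁, h₂⟩ | ⟨h₁, h₂⟩ <;> linarith) rfl).2
  obtain ⟨h2, h3⟩ := neg_pos_of_mul_neg (mul_comm C.t034 _ ▸ h.2) (c := C.t014 - C.t013)
    (by linarith) (by linear_combination -C.lin2)
  exact ⟨h1, h3, h2⟩

theorem Cr13.signs (h : C.Cr13) (h0 : 0 < C.t123) : C.t124 < 0 ∧ C.t134 < 0 ∧ 0 < C.t234 := by
  have h1 : C.t124 < 0 := neg_of_mul_neg_right h.1 h0.le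
  obtain ⟨h2, h3⟩ := neg_pos_of_mul_neg h.2 (c := C.t123 - C.t124) (by linarith)
    (by linear_combination C.lin0)
  exact ⟨h1, h2, h3⟩

theorem Cr02.ne_zero (h : C.Cr02) : C.t012 ≠ 0 := left_ne_zero_of_mul h.1.ne

/-- Properties that do not depend on the side from which one looks may be proved under the
assumption that the triangle `012` is positively oriented. -/
theorem Cr02.wlog {P : OrientedAreas → Prop} (h : C.Cr02) (hP : P C.neg → P C)
    (H : ∀ D : OrientedAreas, D = C ∨ D = C.neg → D.Cr02 → 0 < D.t012 → P D) : P C := by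
  rcases h.ne_zero.lt_or_gt with h0 | h0
  · exact hP (H _ (.inr rfl) (C.cr02_neg.2 h) (neg_pos.2 h0))
  · exact H _ (.inl rfl) h h0

/-- The Plücker relations `quad1` and `quad3` write `t014 * t123` and `t034 * t123` as sums of two
terms which the two given crossings make positive. -/
theorem Cr02.cr03 (h : C.Cr02) (h' : C.Cr13) : C.Cr03 := by
  refine h.wlog (P := fun D => D.Cr13 → D.Cr03)
    (fun k h' => C.cr03_neg.1 (k (C.cr13_neg.2 h'))) (fun D _ h h0 h' => ?_) h'
  obtain ⟨a1, a2, a3⟩ := h.signs h0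
  obtain ⟨b1, b2, b3⟩ := h'.signs a3
  have e1 : 0 < D.t014 * D.t123 := by
    have : D.t014 * D.t123 = D.t012 * -D.t134 + D.t013 * D.t124 := by
      linear_combination D.quad1
    rw [this]
    exact add_pos (mul_pos h0 (neg_pos.2 b2)) (mul_pos_of_neg_of_neg a1 b1)
  have e2 : 0 < D.t034 * D.t123 := by
    have : D.t034 * D.t123 = -D.t013 * D.t234 + D.t023 * D.t134 := by
      linear_combination D.quad3
    rw [this]
    exact add_pos (mul_pos (neg_pos.2 a1) b3) (mul_pos_of_neg_of_neg a2 b2)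
  exact ⟨mul_neg_of_neg_of_pos a1 (pos_of_mul_pos_left e1 a3.le),
    mul_neg_of_pos_of_neg (pos_of_mul_pos_left e2 a3.le) b2⟩

theorem Cr02.order_pos (h : C.Cr02) (h' : C.Cr13) : 0 < C.t012 * C.t234 := by
  refine h.wlog (P := fun D => D.Cr13 → 0 < D.t012 * D.t234)
    (fun k h' => by simpa [neg] using k (C.cr13_neg.2 h')) (fun D _ h h0 h' => ?_) h'
  exact mul_pos h0 (h'.signs (h.signs h0).2.2).2.2

/-- If all three pairs of segments cross, then not all crossings are positive. -/
theorem not_all_pos (h : C.Cr02) (h' : C.Cr13) (h0 : 0 < C.v0) (h2 : 0 < C.v2)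
    (h4 : 0 < C.v4) : False := by
  have h3 := h.cr03 h'
  refine h.wlog (P := fun D => D.Cr13 → D.Cr03 → 0 < D.v0 → 0 < D.v2 → 0 < D.v4 → False)
    (fun k h' h3 h0 h2 h4 => k (C.cr13_neg.2 h') (C.cr03_neg.2 h3) h0 h2 h4)
    (fun D _ h h0 h' h3 w0 w2 w4 => ?_) h' h3 h0 h2 h4
  obtain ⟨a1, a2, a3⟩ := h.signs h0
  obtain ⟨b1, b2, b3⟩ := h'.signs a3
  obtain ⟨c1, c2, c3⟩ := h3.signs a1
  -- The relation `edge01` forces `v3 < 0`; then the three terms of `edge14` are all positive and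
  -- cannot sum to zero.
  have e3 : D.v3 < 0 := by
    have : 0 < D.v3 * D.t013 := by
      rw [show D.v3 * D.t013 = D.v4 * D.t014 + D.v2 * D.t012 by linear_combination -D.edge01]
      positivity
    exact neg_of_mul_pos_left this a1.le
  have := mul_pos_of_neg_of_neg e3 b2
  have := mul_neg_of_pos_of_neg w2 b1
  have := mul_pos w0 c1
  linarith [D.edge14]

theorem not_all_neg (h : C.Cr02) (h' : C.Cr13) (h0 : C.v0 < 0) (h2 : C.v2 < 0)
    (h4 : C.v4 < 0) : False :=
  not_all_pos (C := C.mirror) h h' (neg_pos.2 h0) (neg_pos.2 h2) (neg_pos.2 h4)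

/-- The order in which the segment `01` meets the segments `23` and `34`. -/
theorem exists_param_sub_eq (h : C.Cr02) (h' : C.Cr03) : ∃ K : ℝ, 0 < K ∧
    C.t034 / (C.t034 - C.t134) - C.t023 / (C.t023 - C.t123) = K * (C.t012 * C.t234) := by
  have hd : (C.t034 - C.t134) * (C.t023 - C.t123) < 0 := by
    refine h.wlog (P := fun D => D.Cr03 → (D.t034 - D.t134) * (D.t023 - D.t123) < 0)
      (fun k h' => by
        have := k (C.cr03_neg.2 h'); simp only [neg] at this; linarith)
      (fun D _ h h0 h' => ?_) h'
    obtain ⟨a1, a2, a3⟩ := h.signs h0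
    obtain ⟨c1, c2, c3⟩ := h'.signs a1
    exact mul_neg_of_pos_of_neg (by linarith) (by linarith)
  have d1 := left_ne_zero_of_mul hd.ne
  have d2 := right_ne_zero_of_mul hd.ne
  have h0 := h.ne_zero
  -- By `quad3` the difference of the parameters is `t013 * t234` divided by the two denominators.
  -- Multiplying by `t012 ^ 2 / t012 ^ 2` splits off `t012 * t234`, and the rest is a quotient of
  -- two negative numbers.
  refine ⟨C.t012 * C.t013 / (C.t012 ^ 2 * ((C.t034 - C.t134) * (C.t023 - C.t123))),
    div_pos_of_neg_of_neg h.1 (mul_neg_of_pos_of_neg (by positivity) hd), ?_⟩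
  field_simp
  linear_combination -C.quad3

/-- The order in which the segment `34` meets the segments `01` and `12`. -/
theorem exists_param_sub_eq' (h : C.Cr13) (h' : C.Cr03) : ∃ K : ℝ, 0 < K ∧
    C.t123 / (C.t123 - C.t124) - C.t013 / (C.t013 - C.t014) = K * (C.t012 * C.t234) := by
  have hd : (C.t123 - C.t124) * (C.t013 - C.t014) < 0 := by
    rw [show C.t123 - C.t124 = C.t234 - C.t134 by linear_combination -C.lin0,
      show C.t013 - C.t014 = C.t134 - C.t034 by linear_combination -C.lin2]
    rcases mul_neg_iff.1 h.2 with ⟨a, b⟩ | ⟨a, b⟩ <;>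
      rcases mul_neg_iff.1 h'.2 with ⟨c, d⟩ | ⟨c, d⟩ <;>
      first
      | linarith
      | exact mul_neg_of_pos_of_neg (by linarith) (by linarith)
      | exact mul_neg_of_neg_of_pos (by linarith) (by linarith)
  have d1 := left_ne_zero_of_mul hd.ne
  have d2 := right_ne_zero_of_mul hd.ne
  have h0 := right_ne_zero_of_mul h.2.ne
  -- Here `quad1` gives the numerator `t012 * t134`, which is expanded by `t234 ^ 2`.
  refine ⟨C.t134 * C.t234 / (C.t234 ^ 2 * ((C.t123 - C.t124) * (C.t013 - C.t014))),
    div_pos_of_neg_of_neg h.2 (mul_neg_of_pos_of_neg (by positivity) hd), ?_⟩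
  field_simp
  linear_combination -C.quad1

/-- The chain passes across the line `01` along `23` and comes back along `34`, so the two crossings
have opposite orientations. -/
theorem Cr02.orientation_mul_neg (h : C.Cr02) (h' : C.Cr03) :
    (C.t023 - C.t123) * (C.t034 - C.t134) < 0 := by
  refine h.wlog (P := fun D => D.Cr03 → (D.t023 - D.t123) * (D.t034 - D.t134) < 0)
    (fun k h' => by
      have := k (C.cr03_neg.2 h'); simp only [neg] at this; linarith)
    (fun D _ h h0 h' => ?_) h'
  obtain ⟨a1, a2, a3⟩ := h.signs h0
  obtain ⟨c1, c2, c3⟩ := h'.signs a1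
  exact mul_neg_of_neg_of_pos (by linarith) (by linarith)

theorem Cr13.orientation_mul_neg (h : C.Cr13) (h' : C.Cr03) :
    (C.t034 - C.t134) * (C.t134 - C.t234) < 0 := by
  rcases mul_neg_iff.1 h.2 with ⟨a, b⟩ | ⟨a, b⟩ <;>
    rcases mul_neg_iff.1 h'.2 with ⟨c, d⟩ | ⟨c, d⟩ <;>
    first
    | linarith
    | exact mul_neg_of_pos_of_neg (by linarith) (by linarith)
    | exact mul_neg_of_neg_of_pos (by linarith) (by linarith)

/-- The segment `01` crosses first `23` and then `34`, and there are no other crossings. -/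
def Bi : Prop := C.Cr02 ∧ C.Cr03 ∧ ¬C.Cr13 ∧ 0 < C.t012 * C.t234

theorem bi_neg : Bi (C := C.neg) ↔ Bi (C := C) := by
  rw [Bi, Bi, cr02_neg, cr03_neg, cr13_neg]; simp [neg]

/-- All other inequalities of `Cr13` hold here, so its failure means `0 ≤ t124`. The signs of `v3`,
`v0` and `v1` then follow in turn from `edge01`, `edge12` and `edge23`. -/
theorem Bi.signs (h : Bi (C := C)) (h0 : 0 < C.t012) (h4 : 0 < C.v4) (h2 : 0 < C.v2) :
    C.v3 < 0 ∧ C.v0 < 0 ∧ 0 < C.v1 ∧ 0 < C.t014 ∧ 0 ≤ C.t124 ∧ 0 < C.t234 ∧ C.t023 < 0 := by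
  obtain ⟨h02, h03, h13, hor⟩ := h
  obtain ⟨a1, a2, a3⟩ := h02.signs h0
  obtain ⟨c1, c2, c3⟩ := h03.signs a1
  have b3 : 0 < C.t234 := pos_of_mul_pos_right hor h0.le
  have b1 : 0 ≤ C.t124 := by
    by_contra! hb
    exact h13 ⟨mul_neg_of_pos_of_neg a3 hb, mul_neg_of_neg_of_pos c3 b3⟩
  have e3 : C.v3 < 0 := by
    have : 0 < C.v3 * C.t013 := by
      rw [show C.v3 * C.t013 = C.v4 * C.t014 + C.v2 * C.t012 by linear_combination -C.edge01]
      positivity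
    exact neg_of_mul_pos_left this a1.le
  have e0 : C.v0 < 0 := by
    have : C.v0 * C.t012 < 0 := by
      have := mul_neg_of_neg_of_pos e3 a3
      have := mul_nonneg h4.le b1
      linarith [C.edge12]
    exact neg_of_mul_neg_left this h0.le
  have e1 : 0 < C.v1 := by
    have : 0 < C.v1 * C.t123 := by
      rw [show C.v1 * C.t123 = C.v4 * C.t234 + C.v0 * C.t023 by linear_combination -C.edge23]
      exact add_pos (mul_pos h4 b3) (mul_pos_of_neg_of_neg e0 a2)
    exact pos_of_mul_pos_left this a3.le
  exact ⟨e3, e0, e1, c1, b1, b3, a2⟩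

/-- Converse of `Bi.signs`: three areas and the volumes determine the signs of the other areas
through the edge relations. Only `t023` may need a hypothesis of its own. -/
theorem bi_of_signs (h4 : 0 < C.v4) (h2 : 0 < C.v2) (h3 : C.v3 < 0) (h0 : C.v0 < 0)
    (h1 : 0 < C.v1) (hx : 0 < C.t014) (hy : 0 < C.t124) (hz : 0 < C.t234)
    (hc : C.v1 ≤ C.v4 → C.t023 < 0) : Bi (C := C) := by
  have e134 : C.t134 < 0 := by
    have : 0 < C.v3 * C.t134 := by
      rw [show C.v3 * C.t134 = C.v2 * C.t124 + -C.v0 * C.t014 by linear_combination C.edge14]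
      exact add_pos (mul_pos h2 hy) (mul_pos (neg_pos.2 h0) hx)
    exact neg_of_mul_pos_right this h3.le
  have e024 : C.t024 < 0 := by
    have : 0 < C.v0 * C.t024 := by
      rw [show C.v0 * C.t024 = C.v1 * C.t124 + -C.v3 * C.t234 by linear_combination C.edge24]
      exact add_pos (mul_pos h1 hy) (mul_pos (neg_pos.2 h3) hz)
    exact neg_of_mul_pos_right this h0.le
  have e012 : 0 < C.t012 := by linarith [C.lin3]
  have e013 : C.t013 < 0 := by
    have : 0 < C.v3 * C.t013 := by
      rw [show C.v3 * C.t013 = C.v4 * C.t014 + C.v2 * C.t012 by linear_combination -C.edge01]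
      positivity
    exact neg_of_mul_pos_right this h3.le
  have e123 : 0 < C.t123 := by linarith [C.lin0]
  have e034 : 0 < C.t034 := by
    have : C.v0 * C.t034 < 0 := by
      have := mul_neg_of_pos_of_neg h1 e134
      have := mul_pos h2 hz
      linarith [C.edge34]
    exact pos_of_mul_neg_right this h0.le
  have e023 : C.t023 < 0 := by
    -- If `v4 < v1`, then `t234 < t123` makes `v1 * t123 - v4 * t234`, which is `v0 * t023` by
    -- `edge23`, positive. This is why one polygon of the closed form needs no side with normal
    -- `n₁`.
    rcases le_or_gt C.v1 C.v4 with h | h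
    · exact hc h
    · have : 0 < C.v0 * C.t023 := by
        have e : C.t234 < C.t123 := by linarith [C.lin0]
        have := mul_lt_mul'' h e h4.le hz.le
        linarith [C.edge23]
      exact neg_of_mul_pos_right this h0.le
  refine ⟨⟨mul_neg_of_pos_of_neg e012 e013, mul_neg_of_neg_of_pos e023 e123⟩,
    ⟨mul_neg_of_neg_of_pos e013 hx, mul_neg_of_pos_of_neg e034 e134⟩, fun h => ?_,
    mul_pos e012 hz⟩
  exact (mul_pos e123 hy).not_gt h.1

end OrientedAreas

/-! ### Triple products and crossings -/

theorem cross_apply_zero (x y : E3) : cross x y 0 = x 1 * y 2 - x 2 * y 1 := by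
  simp [cross, crossProduct]

theorem cross_apply_one (x y : E3) : cross x y 1 = x 2 * y 0 - x 0 * y 2 := by
  simp [cross, crossProduct]

theorem cross_apply_two (x y : E3) : cross x y 2 = x 0 * y 1 - x 1 * y 0 := by
  simp [cross, crossProduct]

theorem inner_eq_coords (x y : E3) : ⟪x, y⟫ = x 0 * y 0 + x 1 * y 1 + x 2 * y 2 := by
  simp [PiLp.inner_apply, Fin.sum_univ_three, mul_comm]

theorem triple_eq_coords (x y z : E3) : triple x y z =
    (x 1 * y 2 - x 2 * y 1) * z 0 + (x 2 * y 0 - x 0 * y 2) * z 1 +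
      (x 0 * y 1 - x 1 * y 0) * z 2 := by
  rw [triple, inner_eq_coords, cross_apply_zero, cross_apply_one, cross_apply_two]

theorem triple_neg_right (x y z : E3) : triple x y (-z) = -triple x y z := inner_neg_right _ _

theorem triple_sub_coords (x x' y y' z : E3) : triple (x - x') (y - y') z =
    ((x 1 - x' 1) * (y 2 - y' 2) - (x 2 - x' 2) * (y 1 - y' 1)) * z 0 +
    ((x 2 - x' 2) * (y 0 - y' 0) - (x 0 - x' 0) * (y 2 - y' 2)) * z 1 +
      ((x 0 - x' 0) * (y 1 - y' 1) - (x 1 - x' 1) * (y 0 - y' 0)) * z 2 := by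
  simp only [triple_eq_coords, PiLp.sub_apply]

theorem triple_sub_sub_coords (x x' y y' z z' : E3) : triple (x - x') (y - y') (z - z') =
    ((x 1 - x' 1) * (y 2 - y' 2) - (x 2 - x' 2) * (y 1 - y' 1)) * (z 0 - z' 0) +
    ((x 2 - x' 2) * (y 0 - y' 0) - (x 0 - x' 0) * (y 2 - y' 2)) * (z 1 - z' 1) +
      ((x 0 - x' 0) * (y 1 - y' 1) - (x 1 - x' 1) * (y 0 - y' 0)) * (z 2 - z' 2) := by
  simp only [triple_eq_coords, PiLp.sub_apply]

/-- The three-term Plücker relation for four vectors in the plane obtained by projecting along `u`.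
-/
theorem triple_pluecker (u x y z w : E3) : triple u x y * triple u z w -
    triple u x z * triple u y w + triple u y z * triple u x w = 0 := by
  simp only [triple_eq_coords]; ring

namespace Chain

/-- The oriented area of the projection of a triangle of vertices (up to a factor). -/
noncomputable def area (p : Fin 5 → E3) (ξ : E3) (i j k : Fin 5) : ℝ := triple (p j - p i) (p k - p i) ξ

/-- The oriented volume of a tetrahedron of vertices (up to a factor). -/
noncomputable def vol (p : Fin 5 → E3) (i j k l : Fin 5) : ℝ := triple (p j - p i) (p k - p i) (p l - p i)

section identities

variable (p : Fin 5 → E3) (ξ : E3) (a b c d e : Fin 5)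

theorem area_lin : area p ξ b c d - area p ξ a c d + area p ξ a b d - area p ξ a b c = 0 := by
  simp only [area, triple_sub_coords]; ring

theorem area_quad : area p ξ a b c * area p ξ a d e - area p ξ a b d * area p ξ a c e +
    area p ξ a b e * area p ξ a c d = 0 := by
  simp only [area, triple_sub_coords]; ring

theorem vol_edge : vol p a b c d * area p ξ a b e - vol p a b c e * area p ξ a b d +
    vol p a b d e * area p ξ a b c = 0 := triple_pluecker _ _ _ _ _

theorem vol_sum : vol p b c d e - vol p a c d e + vol p a b d e - vol p a b c e +
    vol p a b c d = 0 := by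
  simp only [vol, triple_sub_sub_coords]; ring

variable {a b c d}

/-- The inequalities here and below direct the antisymmetries, so that they serve as rewriting rules
which sort the indices. -/
theorem area_swap₁ (_ : a < b) : area p ξ b a c = -area p ξ a b c := by
  simp only [area, triple_sub_coords]; ring

theorem area_swap₂ (_ : b < c) : area p ξ a c b = -area p ξ a b c := by
  simp only [area, triple_sub_coords]; ring

theorem vol_swap₁ (_ : a < b) : vol p b a c d = -vol p a b c d := by
  simp only [vol, triple_sub_sub_coords]; ring

theorem vol_swap₂ (_ : b < c) : vol p a c b d = -vol p a b c d := by
  simp only [vol, triple_sub_sub_coords]; ring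

theorem vol_swap₃ (_ : c < d) : vol p a b d c = -vol p a b c d := by
  simp only [vol, triple_sub_sub_coords]; ring

end identities

/-- The areas of the triangles and the volumes of the tetrahedra of a chain with four edges. -/
noncomputable def areas (p : Fin 5 → E3) (ξ : E3) : OrientedAreas where
  t012 := area p ξ 0 1 2
  t013 := area p ξ 0 1 3
  t014 := area p ξ 0 1 4
  t023 := area p ξ 0 2 3
  t024 := area p ξ 0 2 4
  t034 := area p ξ 0 3 4
  t123 := area p ξ 1 2 3
  t124 := area p ξ 1 2 4
  t134 := area p ξ 1 3 4
  t234 := area p ξ 2 3 4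
  v0 := vol p 1 2 3 4
  v1 := vol p 0 2 3 4
  v2 := vol p 0 1 3 4
  v3 := vol p 0 1 2 4
  v4 := vol p 0 1 2 3
  lin0 := area_lin p ξ 1 2 3 4
  lin1 := area_lin p ξ 0 2 3 4
  lin2 := area_lin p ξ 0 1 3 4
  lin3 := area_lin p ξ 0 1 2 4
  lin4 := area_lin p ξ 0 1 2 3
  quad0 := area_quad p ξ 0 1 2 3 4
  quad1 := by
    have := area_quad p ξ 1 0 2 3 4
    simp (disch := decide) only [area_swap₁, area_swap₂] at this
    linear_combination -this
  quad2 := by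
    have := area_quad p ξ 2 0 1 3 4
    simp (disch := decide) only [area_swap₁, area_swap₂] at this
    linear_combination this
  quad3 := by
    have := area_quad p ξ 3 0 1 2 4
    simp (disch := decide) only [area_swap₁, area_swap₂] at this
    linear_combination -this
  quad4 := by
    have := area_quad p ξ 4 0 1 2 3
    simp (disch := decide) only [area_swap₁, area_swap₂] at this
    linear_combination this
  edge01 := vol_edge p ξ 0 1 2 3 4
  edge02 := by
    have := vol_edge p ξ 0 2 1 3 4
    simp (disch := decide) only [area_swap₁, area_swap₂, vol_swap₁, vol_swap₂, vol_swap₃] at this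
    linear_combination -this
  edge03 := by
    have := vol_edge p ξ 0 3 1 2 4
    simp (disch := decide) only [area_swap₁, area_swap₂, vol_swap₁, vol_swap₂, vol_swap₃] at this
    linear_combination this
  edge12 := by
    have := vol_edge p ξ 1 2 0 3 4
    simp (disch := decide) only [area_swap₁, area_swap₂, vol_swap₁, vol_swap₂, vol_swap₃] at this
    linear_combination this
  edge14 := by
    have := vol_edge p ξ 1 4 0 2 3
    simp (disch := decide) only [area_swap₁, area_swap₂, vol_swap₁, vol_swap₂, vol_swap₃] at this
    linear_combination this
  edge23 := by
    have := vol_edge p ξ 2 3 0 1 4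
    simp (disch := decide) only [area_swap₁, area_swap₂, vol_swap₁, vol_swap₂, vol_swap₃] at this
    linear_combination this
  edge24 := by
    have := vol_edge p ξ 2 4 0 1 3
    simp (disch := decide) only [area_swap₁, area_swap₂, vol_swap₁, vol_swap₂, vol_swap₃] at this
    linear_combination -this
  edge34 := by
    have := vol_edge p ξ 3 4 0 1 2
    simp (disch := decide) only [area_swap₁, area_swap₂, vol_swap₁, vol_swap₂, vol_swap₃] at this
    linear_combination this
  vol := vol_sum p 0 1 2 3 4

/-! ### Crossings and their signs -/

/-- The quotient is the zero of the affine function with values `a` at 0 and `b` at 1. -/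
theorem div_sub_mem_Ioo (a b : ℝ) : a / (a - b) ∈ Set.Ioo (0 : ℝ) 1 ↔ a * b < 0 := by
  constructor
  · rintro ⟨h0, h1⟩
    rcases div_pos_iff.1 h0 with ⟨ha, hb⟩ | ⟨ha, hb⟩
    · exact mul_neg_of_pos_of_neg ha (by linarith [(div_lt_one hb).1 h1])
    · exact mul_neg_of_neg_of_pos ha (by linarith [(div_lt_one_of_neg hb).1 h1])
  · intro h
    rcases mul_neg_iff.1 h with ⟨ha, hb⟩ | ⟨ha, hb⟩
    · exact ⟨div_pos ha (by linarith), (div_lt_one (by linarith)).2 (by linarith)⟩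
    · exact ⟨div_pos_of_neg_of_neg ha (by linarith),
        (div_lt_one_of_neg (by linarith)).2 (by linarith)⟩

section crossings

variable (p : Fin 5 → E3) (ξ : E3)

theorem crossParam_eq (i j : Fin 4) : crossParam p ξ i j =
    area p ξ i.castSucc j.castSucc j.succ /
      (area p ξ i.castSucc j.castSucc j.succ - area p ξ i.succ j.castSucc j.succ) := by
  rw [crossParam]
  congr 1 <;> simp only [edge, area, triple_sub_coords] <;> ring

theorem crossParam_mem_iff (i j : Fin 4) : crossParam p ξ i j ∈ Set.Ioo (0 : ℝ) 1 ↔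
    area p ξ i.castSucc j.castSucc j.succ * area p ξ i.succ j.castSucc j.succ < 0 := by
  rw [crossParam_eq, div_sub_mem_Ioo]

theorem crosses_comm (i j : Fin 4) : Crosses p ξ i j ↔ Crosses p ξ j i := and_comm

theorem not_crosses_self (i : Fin 4) : ¬Crosses p ξ i i := by
  have : area p ξ i.castSucc i.castSucc i.succ = 0 := by
    simp only [area, triple_sub_coords]; ring
  simp only [Crosses, crossParam_mem_iff, this, zero_mul, lt_irrefl, false_and, not_false_iff]

theorem not_crosses_succ {i j : Fin 4} (h : i.succ = j.castSucc) : ¬Crosses p ξ i j := by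
  have : area p ξ j.castSucc j.castSucc j.succ = 0 := by
    simp only [area, triple_sub_coords]; ring
  simp only [Crosses, crossParam_mem_iff, h, this, mul_zero, zero_mul, lt_irrefl, false_and,
    and_false, not_false_iff]

theorem crosses_zero_two : Crosses p ξ 0 2 ↔ (areas p ξ).Cr02 := by
  simp only [Crosses, crossParam_mem_iff]
  change area p ξ 0 2 3 * area p ξ 1 2 3 < 0 ∧ area p ξ 2 0 1 * area p ξ 3 0 1 < 0 ↔
    area p ξ 0 1 2 * area p ξ 0 1 3 < 0 ∧ area p ξ 0 2 3 * area p ξ 1 2 3 < 0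
  simp (disch := decide) only [area_swap₁, area_swap₂, neg_neg]
  exact and_comm

theorem crosses_zero_three : Crosses p ξ 0 3 ↔ (areas p ξ).Cr03 := by
  simp only [Crosses, crossParam_mem_iff]
  change area p ξ 0 3 4 * area p ξ 1 3 4 < 0 ∧ area p ξ 3 0 1 * area p ξ 4 0 1 < 0 ↔
    area p ξ 0 1 3 * area p ξ 0 1 4 < 0 ∧ area p ξ 0 3 4 * area p ξ 1 3 4 < 0
  simp (disch := decide) only [area_swap₁, area_swap₂, neg_neg]
  exact and_comm

theorem crosses_one_three : Crosses p ξ 1 3 ↔ (areas p ξ).Cr13 := by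
  simp only [Crosses, crossParam_mem_iff]
  change area p ξ 1 3 4 * area p ξ 2 3 4 < 0 ∧ area p ξ 3 1 2 * area p ξ 4 1 2 < 0 ↔
    area p ξ 1 2 3 * area p ξ 1 2 4 < 0 ∧ area p ξ 1 3 4 * area p ξ 2 3 4 < 0
  simp (disch := decide) only [area_swap₁, area_swap₂, neg_neg]
  exact and_comm

theorem crossParam_zero_two : crossParam p ξ 0 2 =
    (areas p ξ).t023 / ((areas p ξ).t023 - (areas p ξ).t123) := crossParam_eq p ξ 0 2

theorem crossParam_zero_three : crossParam p ξ 0 3 =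
    (areas p ξ).t034 / ((areas p ξ).t034 - (areas p ξ).t134) := crossParam_eq p ξ 0 3

theorem crossParam_three_zero : crossParam p ξ 3 0 =
    (areas p ξ).t013 / ((areas p ξ).t013 - (areas p ξ).t014) := by
  rw [crossParam_eq]
  change area p ξ 3 0 1 / (area p ξ 3 0 1 - area p ξ 4 0 1) =
    area p ξ 0 1 3 / (area p ξ 0 1 3 - area p ξ 0 1 4)
  simp (disch := decide) only [area_swap₁, area_swap₂, neg_neg]

theorem crossParam_three_one : crossParam p ξ 3 1 =
    (areas p ξ).t123 / ((areas p ξ).t123 - (areas p ξ).t124) := by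
  rw [crossParam_eq]
  change area p ξ 3 1 2 / (area p ξ 3 1 2 - area p ξ 4 1 2) =
    area p ξ 1 2 3 / (area p ξ 1 2 3 - area p ξ 1 2 4)
  simp (disch := decide) only [area_swap₁, area_swap₂, neg_neg]

/-- The signed volume spanned by two edges. -/
noncomputable def edgeVol (i j : Fin 4) : ℝ :=
  triple (edge p i) (edge p j) (p i.castSucc - p j.castSucc)

variable {p ξ}

/-- The two points over a crossing differ by a multiple of the direction; Cramer's rule determines
the multiple. -/
theorem smul_crossing_sub {i j : Fin 4} (h : triple (edge p i) (edge p j) ξ ≠ 0) :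
    triple (edge p i) (edge p j) ξ • ((p i.castSucc + crossParam p ξ i j • edge p i) -
      (p j.castSucc + crossParam p ξ j i • edge p j)) = edgeVol p i j • ξ := by
  have h' : triple (edge p j) (edge p i) ξ = -triple (edge p i) (edge p j) ξ := by
    simp only [triple_eq_coords]; ring
  have hs : triple (edge p i) (edge p j) ξ * crossParam p ξ i j =
      triple (p j.castSucc - p i.castSucc) (edge p j) ξ := by
    rw [crossParam, mul_div_cancel₀ _ h]
  have ht : triple (edge p i) (edge p j) ξ * crossParam p ξ j i =
      -triple (p i.castSucc - p j.castSucc) (edge p i) ξ := by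
    rw [crossParam, h', div_neg, mul_neg, mul_div_cancel₀ _ h]
  -- The linear relation between four vectors of 3-space: the two edges, the direction and the
  -- difference of the initial points.
  have key : triple (edge p i) (edge p j) ξ • (p i.castSucc - p j.castSucc) +
      triple (p j.castSucc - p i.castSucc) (edge p j) ξ • edge p i +
      triple (p i.castSucc - p j.castSucc) (edge p i) ξ • edge p j = edgeVol p i j • ξ := by
    ext k
    fin_cases k <;> simp [edgeVol, triple_eq_coords] <;> ring
  rw [← key, ← hs, ← neg_neg (triple (p i.castSucc - _) _ _), ← ht]
  module

theorem Crosses.triple_ne_zero {i j : Fin 4} (h : Crosses p ξ i j) :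
    triple (edge p i) (edge p j) ξ ≠ 0 := by
  intro h0
  have := h.1.1
  simp [crossParam, h0] at this

theorem height_sub_mul {i j : Fin 4} (h : Crosses p ξ i j) (hξ : ⟪ξ, ξ⟫ = 1) :
    (height p ξ i j - height p ξ j i) * triple (edge p i) (edge p j) ξ = edgeVol p i j := by
  have := congrArg (fun x => ⟪x, ξ⟫) (smul_crossing_sub h.triple_ne_zero)
  simp only [inner_smul_left, inner_sub_left, hξ] at this
  simp only [height, mul_comm]
  simpa using this

theorem crossing_mem_segment {i j : Fin 4} (h : Crosses p ξ i j) :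
    p i.castSucc + crossParam p ξ i j • edge p i ∈ segment ℝ (p i.castSucc) (p i.succ) := by
  rw [segment_eq_image']
  exact ⟨_, ⟨h.1.1.le, h.1.2.le⟩, rfl⟩

/-- If the volume vanished, the two points over the crossing would coincide and the edges would
meet. -/
theorem edgeVol_ne_zero (hp : IsSimple p) {i j : Fin 4} (hij : (i : ℕ) + 1 < j)
    (h : Crosses p ξ i j) : edgeVol p i j ≠ 0 := by
  intro h0
  have := smul_crossing_sub h.triple_ne_zero
  rw [h0, zero_smul, smul_eq_zero_iff_right h.triple_ne_zero, sub_eq_zero] at this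
  exact Set.disjoint_left.1 (hp.disjoint i j hij) (crossing_mem_segment h)
    (this ▸ crossing_mem_segment ((crosses_comm p ξ i j).1 h))

/-- The volume is the height difference times the orientation of the projected edges. Exchanging the
strands negates both factors, so the sign of the crossing is the sign of the volume, whichever edge
is on top. -/
theorem visit_eq (hp : IsSimple p) {i j : Fin 4} (hij : (i : ℕ) + 1 < j)
    (h : Crosses p ξ i j) (hξ : ⟪ξ, ξ⟫ = 1) : visit p ξ i j = ⟨crossingLabel i j,
      decide (0 < edgeVol p i j * triple (edge p i) (edge p j) ξ),
      decide (0 < edgeVol p i j)⟩ := by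
  have h0 := edgeVol_ne_zero hp hij h
  have hD := h.triple_ne_zero
  have h' : triple (edge p j) (edge p i) ξ = -triple (edge p i) (edge p j) ξ := by
    simp only [triple_eq_coords]; ring
  have hv := height_sub_mul h hξ
  have e : height p ξ j i < height p ξ i j ↔
      0 < edgeVol p i j * triple (edge p i) (edge p j) ξ := by
    rw [← hv, mul_assoc, mul_pos_iff_of_pos_right (mul_self_pos.2 hD), sub_pos]
  rw [visit]
  congr 1
  · simp only [e]
  · rw [decide_eq_decide, h']
    split_ifs with hlt
    · rw [← hv, mul_pos_iff_of_pos_left (sub_pos.2 hlt)]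
    · have : height p ξ i j - height p ξ j i < 0 :=
        lt_of_le_of_ne (by linarith) fun h1 => h0 (by rw [← hv, h1, zero_mul])
      rw [← hv, neg_pos]
      exact ⟨mul_pos_of_neg_of_neg this, fun h => neg_of_mul_pos_right h this.le⟩

theorem visit_comm (hp : IsSimple p) {i j : Fin 4} (hij : (i : ℕ) + 1 < j)
    (h : Crosses p ξ i j) (hξ : ⟪ξ, ξ⟫ = 1) : visit p ξ j i = (visit p ξ i j).partner := by
  have h0 := edgeVol_ne_zero hp hij h
  have hv := height_sub_mul h hξ
  have hne : height p ξ i j ≠ height p ξ j i := fun h1 => h0 (by rw [← hv, h1, sub_self, zero_mul])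
  rw [visit, visit, Visit.partner]
  rcases hne.lt_or_gt with hlt | hlt <;>
    simp [hlt, hlt.le, hlt.not_gt, crossingLabel, min_comm i j, max_comm i j]

end crossings

/-- Two consecutive edges of a simple chain that both cross a line in projection are not
collinear. -/
theorem cross_ne_zero_of_hairpin {A B C P Q ξ : E3}
    (hs : segment ℝ A B ∩ segment ℝ B C = {B})
    (h : triple (Q - P) (A - P) ξ * triple (Q - P) (B - P) ξ < 0)
    (h' : triple (Q - P) (B - P) ξ * triple (Q - P) (C - P) ξ < 0) :
    cross (B - A) (C - A) ≠ 0 := by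
  intro h0
  have c0 := congrArg (fun x : E3 => x 0) h0
  have c1 := congrArg (fun x : E3 => x 1) h0
  have c2 := congrArg (fun x : E3 => x 2) h0
  simp only [cross_apply_zero, cross_apply_one, cross_apply_two, PiLp.sub_apply,
    PiLp.zero_apply] at c0 c1 c2
  set L : E3 → ℝ := fun x => triple (Q - P) x ξ with hL
  have hA : L (A - B) = triple (Q - P) (A - P) ξ - triple (Q - P) (B - P) ξ := by
    simp only [hL, triple_sub_coords]; ring
  have hC : L (C - B) = triple (Q - P) (C - P) ξ - triple (Q - P) (B - P) ξ := by
    simp only [hL, triple_sub_coords]; ring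
  -- The two edges pass across the line in opposite directions, so `A` and `C` lie on the same side
  -- of `B`.
  have hpos : 0 < L (A - B) * L (C - B) := by
    rw [hA, hC]
    rcases mul_neg_iff.1 h with ⟨a, b⟩ | ⟨a, b⟩ <;>
      rcases mul_neg_iff.1 h' with ⟨c, d⟩ | ⟨c, d⟩ <;>
      first
      | linarith
      | exact mul_pos (by linarith) (by linarith)
      | exact mul_pos_of_neg_of_neg (by linarith) (by linarith)
  have hA0 : L (A - B) ≠ 0 := left_ne_zero_of_mul hpos.ne'
  have hC0 : L (C - B) ≠ 0 := right_ne_zero_of_mul hpos.ne'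
  have hsm : L (A - B) • (C - B) = L (C - B) • (A - B) := by
    ext k
    simp only [hL]
    fin_cases k <;> simp [triple_eq_coords]
    · linear_combination ((Q 0 - P 0) * ξ 2 - (Q 2 - P 2) * ξ 0) * c2 -
        ((Q 1 - P 1) * ξ 0 - (Q 0 - P 0) * ξ 1) * c1
    · linear_combination -((Q 2 - P 2) * ξ 1 - (Q 1 - P 1) * ξ 2) * c2 +
        ((Q 1 - P 1) * ξ 0 - (Q 0 - P 0) * ξ 1) * c0
    · linear_combination ((Q 2 - P 2) * ξ 1 - (Q 1 - P 1) * ξ 2) * c1 -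
        ((Q 0 - P 0) * ξ 2 - (Q 2 - P 2) * ξ 0) * c0
  have hL0 : L 0 = 0 := by simp [hL, triple_eq_coords]
  have mem : ∀ X Y : E3, ∀ μ : ℝ, 0 < μ → μ ≤ 1 → Y - B = μ • (X - B) →
      Y ∈ segment ℝ X B := by
    intro X Y μ h0 h1 h
    rw [segment_symm, segment_eq_image']
    exact ⟨μ, ⟨h0.le, h1⟩, by simp [← h]⟩
  have hμ : 0 < L (C - B) / L (A - B) := by
    rcases mul_pos_iff.1 hpos with ⟨a, b⟩ | ⟨a, b⟩
    · exact div_pos b a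
    · exact div_pos_of_neg_of_neg b a
  -- Both edges leave `B` on the same ray. The far end of the shorter one lies on the other edge,
  -- although the edges share only `B`.
  rcases le_total (L (C - B) / L (A - B)) 1 with h1 | h1
  · have : C ∈ segment ℝ A B ∩ segment ℝ B C := ⟨mem A C _ hμ h1 (by
      rw [div_eq_inv_mul, mul_smul, ← hsm, smul_smul, inv_mul_cancel₀ hA0, one_smul]),
      right_mem_segment ℝ B C⟩
    rw [hs] at this
    exact hC0 (by rw [Set.mem_singleton_iff.1 this, sub_self, hL0])
  · have : A ∈ segment ℝ A B ∩ segment ℝ B C := ⟨left_mem_segment ℝ A B, by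
      rw [segment_symm]
      refine mem C A (L (A - B) / L (C - B)) ?_ ?_ ?_
      · rw [← inv_div]; exact inv_pos.2 hμ
      · rw [← inv_div]; exact inv_le_one_of_one_le₀ h1
      · rw [div_eq_inv_mul, mul_smul, hsm, smul_smul, inv_mul_cancel₀ hC0, one_smul]⟩
    rw [hs] at this
    exact hA0 (by rw [Set.mem_singleton_iff.1 this, sub_self, hL0])

end Chain

/-! ### The diagrams of a chain with four edges -/

namespace Chain

section diagrams

variable {p : Fin 5 → E3} {ξ : E3}

theorem edgeVol_zero_two : edgeVol p 0 2 = vol p 0 1 2 3 := by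
  change triple (p 1 - p 0) (p 3 - p 2) (p 0 - p 2) = _
  simp only [vol, triple_sub_sub_coords]; ring

theorem edgeVol_zero_three : edgeVol p 0 3 = vol p 0 1 3 4 := by
  change triple (p 1 - p 0) (p 4 - p 3) (p 0 - p 3) = _
  simp only [vol, triple_sub_sub_coords]; ring

theorem edgeVol_one_three : edgeVol p 1 3 = vol p 1 2 3 4 := by
  change triple (p 2 - p 1) (p 4 - p 3) (p 1 - p 3) = _
  simp only [vol, triple_sub_sub_coords]; ring

theorem triple_zero_two : triple (edge p 0) (edge p 2) ξ =
    (areas p ξ).t023 - (areas p ξ).t123 := by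
  change triple (p 1 - p 0) (p 3 - p 2) ξ = area p ξ 0 2 3 - area p ξ 1 2 3
  simp only [area, triple_sub_coords]; ring

theorem triple_zero_three : triple (edge p 0) (edge p 3) ξ =
    (areas p ξ).t034 - (areas p ξ).t134 := by
  change triple (p 1 - p 0) (p 4 - p 3) ξ = area p ξ 0 3 4 - area p ξ 1 3 4
  simp only [area, triple_sub_coords]; ring

theorem triple_one_three : triple (edge p 1) (edge p 3) ξ =
    (areas p ξ).t134 - (areas p ξ).t234 := by
  change triple (p 2 - p 1) (p 4 - p 3) ξ = area p ξ 1 3 4 - area p ξ 2 3 4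
  simp only [area, triple_sub_coords]; ring

open Classical in
/-- The pairs of edges in the order of their passages, if the crossings on the same edge are
ordered lexicographically. -/
noncomputable def passages (p : Fin 5 → E3) (ξ : E3) : List (Fin 4 × Fin 4) :=
  [(0, 2), (0, 3), (1, 3), (2, 0), (3, 0), (3, 1)].filter fun x => Crosses p ξ x.1 x.2

/-- The order of the passages along the chain. -/
def passageLE (p : Fin 5 → E3) (ξ : E3) (x y : Fin 4 × Fin 4) : Prop :=
  (x.1 : ℝ) + crossParam p ξ x.1 x.2 ≤ (y.1 : ℝ) + crossParam p ξ y.1 y.2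

-- An edge crosses neither itself nor a neighbour, so six of the sixteen pairs remain.
open Classical in
theorem diagram_eq : diagram p ξ = ((passages p ξ).insertionSort (passageLE p ξ)).map
    fun x => visit p ξ x.1 x.2 := by
  have e : ((List.finRange 4).product (List.finRange 4)).filter
      (fun x => Crosses p ξ x.1 x.2) = passages p ξ := by
    have h : (List.finRange 4).product (List.finRange 4) =
      [(0, 0), (0, 1), (0, 2), (0, 3), (1, 0), (1, 1), (1, 2), (1, 3), (2, 0), (2, 1), (2, 2),
        (2, 3), (3, 0), (3, 1), (3, 2), (3, 3)] := by decide
    have n (i j : Fin 4) (h : i.succ = j.castSucc) : ¬Crosses p ξ j i := fun hc =>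
      not_crosses_succ p ξ h ((crosses_comm p ξ j i).1 hc)
    rw [h, passages]
    simp [List.filter_cons, not_crosses_self, not_crosses_succ p ξ (i := 0) (j := 1) rfl,
      not_crosses_succ p ξ (i := 1) (j := 2) rfl, not_crosses_succ p ξ (i := 2) (j := 3) rfl,
      n 0 1 rfl, n 1 2 rfl, n 2 3 rfl]
  rw [diagram, e]
  rfl

theorem passageLE_of_lt {i j k l : Fin 4} (h : (i : ℕ) < k) (hx : Crosses p ξ i j)
    (hy : Crosses p ξ k l) : passageLE p ξ (i, j) (k, l) := by
  have : (i : ℝ) + 1 ≤ k := by exact_mod_cast h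
  have := hx.1.2
  have := hy.1.1
  simp only [passageLE]
  linarith

theorem passageLE_iff {i j l : Fin 4} :
    passageLE p ξ (i, j) (i, l) ↔ crossParam p ξ i j ≤ crossParam p ξ i l := by
  simp [passageLE]

theorem crossParam_sub (h : (areas p ξ).Cr02) (h' : (areas p ξ).Cr03) : ∃ K : ℝ, 0 < K ∧
    crossParam p ξ 0 3 - crossParam p ξ 0 2 = K * ((areas p ξ).t012 * (areas p ξ).t234) := by
  rw [crossParam_zero_two, crossParam_zero_three]
  exact OrientedAreas.exists_param_sub_eq h h'

theorem crossParam_sub' (h : (areas p ξ).Cr13) (h' : (areas p ξ).Cr03) : ∃ K : ℝ, 0 < K ∧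
    crossParam p ξ 3 1 - crossParam p ξ 3 0 = K * ((areas p ξ).t012 * (areas p ξ).t234) := by
  rw [crossParam_three_zero, crossParam_three_one]
  exact OrientedAreas.exists_param_sub_eq' h h'

theorem diagram_eq_of_sorted {l : List (Fin 4 × Fin 4)} (h : passages p ξ = l)
    (hl : l.Pairwise (passageLE p ξ)) : diagram p ξ = l.map fun x => visit p ξ x.1 x.2 := by
  classical
  rw [diagram_eq, h]
  congr 1
  exact List.Pairwise.insertionSort_eq hl

theorem diagram_of_none (h02 : ¬Crosses p ξ 0 2) (h03 : ¬Crosses p ξ 0 3)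
    (h13 : ¬Crosses p ξ 1 3) : diagram p ξ = [] := by
  have h20 := (crosses_comm p ξ 0 2).not.1 h02
  have h30 := (crosses_comm p ξ 0 3).not.1 h03
  have h31 := (crosses_comm p ξ 1 3).not.1 h13
  rw [diagram_eq_of_sorted (l := []) (by simp [passages, *]) (by simp)]
  rfl

theorem diagram_of_zero_two (hp : IsSimple p) (hξ : ⟪ξ, ξ⟫ = 1) (h02 : Crosses p ξ 0 2)
    (h03 : ¬Crosses p ξ 0 3) (h13 : ¬Crosses p ξ 1 3) :
    diagram p ξ = GaussCode.kink (visit p ξ 0 2) := by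
  have h20 := (crosses_comm p ξ 0 2).1 h02
  have h30 := (crosses_comm p ξ 0 3).not.1 h03
  have h31 := (crosses_comm p ξ 1 3).not.1 h13
  rw [diagram_eq_of_sorted (l := [(0, 2), (2, 0)]) (by simp [passages, *])
    (by simp [passageLE_of_lt, *])]
  simp [GaussCode.kink, visit_comm hp (i := 0) (j := 2) (by decide) h02 hξ]

theorem diagram_of_zero_three (hp : IsSimple p) (hξ : ⟪ξ, ξ⟫ = 1) (h02 : ¬Crosses p ξ 0 2)
    (h03 : Crosses p ξ 0 3) (h13 : ¬Crosses p ξ 1 3) :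
    diagram p ξ = GaussCode.kink (visit p ξ 0 3) := by
  have h20 := (crosses_comm p ξ 0 2).not.1 h02
  have h30 := (crosses_comm p ξ 0 3).1 h03
  have h31 := (crosses_comm p ξ 1 3).not.1 h13
  rw [diagram_eq_of_sorted (l := [(0, 3), (3, 0)]) (by simp [passages, *])
    (by simp [passageLE_of_lt, *])]
  simp [GaussCode.kink, visit_comm hp (i := 0) (j := 3) (by decide) h03 hξ]

theorem diagram_of_one_three (hp : IsSimple p) (hξ : ⟪ξ, ξ⟫ = 1) (h02 : ¬Crosses p ξ 0 2)
    (h03 : ¬Crosses p ξ 0 3) (h13 : Crosses p ξ 1 3) :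
    diagram p ξ = GaussCode.kink (visit p ξ 1 3) := by
  have h20 := (crosses_comm p ξ 0 2).not.1 h02
  have h30 := (crosses_comm p ξ 0 3).not.1 h03
  have h31 := (crosses_comm p ξ 1 3).1 h13
  rw [diagram_eq_of_sorted (l := [(1, 3), (3, 1)]) (by simp [passages, *])
    (by simp [passageLE_of_lt, *])]
  simp [GaussCode.kink, visit_comm hp (i := 1) (j := 3) (by decide) h13 hξ]

theorem diagram_of_zero (hp : IsSimple p) (hξ : ⟪ξ, ξ⟫ = 1) (h02 : Crosses p ξ 0 2)
    (h03 : Crosses p ξ 0 3) (h13 : ¬Crosses p ξ 1 3)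
    (hor : 0 < (areas p ξ).t012 * (areas p ξ).t234) :
    diagram p ξ = GaussCode.interleaved (visit p ξ 0 2) (visit p ξ 0 3) := by
  have h20 := (crosses_comm p ξ 0 2).1 h02
  have h30 := (crosses_comm p ξ 0 3).1 h03
  have h31 := (crosses_comm p ξ 1 3).not.1 h13
  obtain ⟨K, hK, hle⟩ := crossParam_sub ((crosses_zero_two p ξ).1 h02)
    ((crosses_zero_three p ξ).1 h03)
  have hle : passageLE p ξ (0, 2) (0, 3) :=
    passageLE_iff.2 (sub_nonneg.1 (hle ▸ (mul_pos hK hor).le))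
  rw [diagram_eq_of_sorted (l := [(0, 2), (0, 3), (2, 0), (3, 0)]) (by simp [passages, *])
    (by simp [passageLE_of_lt, *])]
  simp [GaussCode.interleaved, visit_comm hp (i := 0) (j := 2) (by decide) h02 hξ,
    visit_comm hp (i := 0) (j := 3) (by decide) h03 hξ]

theorem diagram_of_three (hp : IsSimple p) (hξ : ⟪ξ, ξ⟫ = 1) (h02 : ¬Crosses p ξ 0 2)
    (h03 : Crosses p ξ 0 3) (h13 : Crosses p ξ 1 3)
    (hor : 0 < (areas p ξ).t012 * (areas p ξ).t234) :
    diagram p ξ = GaussCode.interleaved (visit p ξ 0 3) (visit p ξ 1 3) := by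
  have h20 := (crosses_comm p ξ 0 2).not.1 h02
  have h30 := (crosses_comm p ξ 0 3).1 h03
  have h31 := (crosses_comm p ξ 1 3).1 h13
  obtain ⟨K, hK, hle⟩ := crossParam_sub' ((crosses_one_three p ξ).1 h13)
    ((crosses_zero_three p ξ).1 h03)
  have hle : passageLE p ξ (3, 0) (3, 1) :=
    passageLE_iff.2 (sub_nonneg.1 (hle ▸ (mul_pos hK hor).le))
  rw [diagram_eq_of_sorted (l := [(0, 3), (1, 3), (3, 0), (3, 1)]) (by simp [passages, *])
    (by simp [passageLE_of_lt, *])]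
  simp [GaussCode.interleaved, visit_comm hp (i := 1) (j := 3) (by decide) h13 hξ,
    visit_comm hp (i := 0) (j := 3) (by decide) h03 hξ]

theorem diagram_of_zero' (hp : IsSimple p) (hξ : ⟪ξ, ξ⟫ = 1) (h02 : Crosses p ξ 0 2)
    (h03 : Crosses p ξ 0 3) (h13 : ¬Crosses p ξ 1 3)
    (hor : (areas p ξ).t012 * (areas p ξ).t234 < 0) :
    diagram p ξ = GaussCode.nested (visit p ξ 0 3) (visit p ξ 0 2) := by
  classical
  have h20 := (crosses_comm p ξ 0 2).1 h02
  have h30 := (crosses_comm p ξ 0 3).1 h03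
  have h31 := (crosses_comm p ξ 1 3).not.1 h13
  obtain ⟨K, hK, hle⟩ := crossParam_sub ((crosses_zero_two p ξ).1 h02)
    ((crosses_zero_three p ξ).1 h03)
  have hlt := sub_neg.1 (hle ▸ mul_neg_of_pos_of_neg hK hor)
  have hle : ¬passageLE p ξ (0, 2) (0, 3) := passageLE_iff.not.2 hlt.not_ge
  rw [diagram_eq, show passages p ξ = [(0, 2), (0, 3), (2, 0), (3, 0)] by simp [passages, *]]
  simp [List.orderedInsert, passageLE_of_lt, *, GaussCode.nested,
    visit_comm hp (i := 0) (j := 2) (by decide) h02 hξ,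
    visit_comm hp (i := 0) (j := 3) (by decide) h03 hξ]

theorem diagram_of_three' (hp : IsSimple p) (hξ : ⟪ξ, ξ⟫ = 1) (h02 : ¬Crosses p ξ 0 2)
    (h03 : Crosses p ξ 0 3) (h13 : Crosses p ξ 1 3)
    (hor : (areas p ξ).t012 * (areas p ξ).t234 < 0) :
    diagram p ξ = GaussCode.nested (visit p ξ 0 3) (visit p ξ 1 3) := by
  classical
  have h20 := (crosses_comm p ξ 0 2).not.1 h02
  have h30 := (crosses_comm p ξ 0 3).1 h03
  have h31 := (crosses_comm p ξ 1 3).1 h13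
  obtain ⟨K, hK, hle⟩ := crossParam_sub' ((crosses_one_three p ξ).1 h13)
    ((crosses_zero_three p ξ).1 h03)
  have hlt := sub_neg.1 (hle ▸ mul_neg_of_pos_of_neg hK hor)
  have hle : ¬passageLE p ξ (3, 0) (3, 1) := passageLE_iff.not.2 hlt.not_ge
  rw [diagram_eq, show passages p ξ = [(0, 3), (1, 3), (3, 0), (3, 1)] by simp [passages, *]]
  simp [List.orderedInsert, passageLE_of_lt, *, GaussCode.nested,
    visit_comm hp (i := 1) (j := 3) (by decide) h13 hξ,
    visit_comm hp (i := 0) (j := 3) (by decide) h03 hξ]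

theorem diagram_of_all (hp : IsSimple p) (hξ : ⟪ξ, ξ⟫ = 1) (h02 : Crosses p ξ 0 2)
    (h13 : Crosses p ξ 1 3) : diagram p ξ =
      GaussCode.interleaved₃ (visit p ξ 0 2) (visit p ξ 0 3) (visit p ξ 1 3) := by
  have c02 := (crosses_zero_two p ξ).1 h02
  have c13 := (crosses_one_three p ξ).1 h13
  have c03 := c02.cr03 c13
  have h03 := (crosses_zero_three p ξ).2 c03
  have h20 := (crosses_comm p ξ 0 2).1 h02
  have h30 := (crosses_comm p ξ 0 3).1 h03
  have h31 := (crosses_comm p ξ 1 3).1 h13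
  have hor := c02.order_pos c13
  obtain ⟨K, hK, hle⟩ := crossParam_sub c02 c03
  obtain ⟨K', hK', hle'⟩ := crossParam_sub' c13 c03
  have hle : passageLE p ξ (0, 2) (0, 3) :=
    passageLE_iff.2 (sub_nonneg.1 (hle ▸ (mul_pos hK hor).le))
  have hle' : passageLE p ξ (3, 0) (3, 1) :=
    passageLE_iff.2 (sub_nonneg.1 (hle' ▸ (mul_pos hK' hor).le))
  rw [diagram_eq_of_sorted (l := [(0, 2), (0, 3), (1, 3), (2, 0), (3, 0), (3, 1)])
    (by simp [passages, *]) (by simp [passageLE_of_lt, *])]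
  simp [GaussCode.interleaved₃, visit_comm hp (i := 0) (j := 2) (by decide) h02 hξ,
    visit_comm hp (i := 1) (j := 3) (by decide) h13 hξ,
    visit_comm hp (i := 0) (j := 3) (by decide) h03 hξ]

/-- The direction is a unit vector, and neither the first two nor the last two edges become
parallel in projection, unless they are parallel in space. -/
structure IsGeneric (p : Fin 5 → E3) (ξ : E3) : Prop where
  norm : ⟪ξ, ξ⟫ = 1
  first : cross (p 1 - p 0) (p 2 - p 0) ≠ 0 → area p ξ 0 1 2 ≠ 0
  last : cross (p 3 - p 2) (p 4 - p 2) ≠ 0 → area p ξ 2 3 4 ≠ 0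

/-- One factor is nonzero because of a crossing. The other belongs to two consecutive edges that
both cross a third one; these are not collinear, so a generic direction does not make them parallel.
-/
theorem order_ne_zero (hp : IsSimple p) (hξ : IsGeneric p ξ) (h03 : (areas p ξ).Cr03)
    (h : (areas p ξ).Cr02 ∨ (areas p ξ).Cr13) : (areas p ξ).t012 * (areas p ξ).t234 ≠ 0 := by
  rcases h with h | h
  · refine mul_ne_zero h.ne_zero (hξ.last ?_)
    refine cross_ne_zero_of_hairpin (P := p 0) (Q := p 1) (ξ := ξ) ?_ h.1 h03.1
    exact hp.consecutive 2 3 rfl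
  · refine mul_ne_zero (hξ.first ?_) (right_ne_zero_of_mul h.2.ne)
    refine cross_ne_zero_of_hairpin (P := p 3) (Q := p 4) (ξ := ξ)
      (hp.consecutive 0 1 rfl) ?_ ?_
    · have := h03.2
      change area p ξ 0 3 4 * area p ξ 1 3 4 < 0 at this
      change area p ξ 3 4 0 * area p ξ 3 4 1 < 0
      simpa (disch := decide) only [area_swap₁, area_swap₂, neg_neg] using this
    · have := h.2
      change area p ξ 1 3 4 * area p ξ 2 3 4 < 0 at this
      change area p ξ 3 4 1 * area p ξ 3 4 2 < 0
      simpa (disch := decide) only [area_swap₁, area_swap₂, neg_neg] using this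

theorem _root_.decide_pos_eq {x y : ℝ} (h : 0 < x * y) : decide (0 < y) = decide (0 < x) := by
  rcases mul_pos_iff.1 h with ⟨a, b⟩ | ⟨a, b⟩
  · simp [a, b]
  · simp [a.not_gt, b.not_gt]

theorem _root_.decide_pos_eq_not {x y : ℝ} (h : x * y < 0) :
    decide (0 < y) = !decide (0 < x) := by
  rcases mul_neg_iff.1 h with ⟨a, b⟩ | ⟨a, b⟩
  · simp [a, b.not_gt]
  · simp [a.not_gt, b]

/-- The projection is the diagram `k2.1_{Bi}`. -/
def BiDirection (p : Fin 5 → E3) (ξ : E3) : Prop :=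
  OrientedAreas.Bi (C := areas p ξ) ∧ 0 < (areas p ξ).v4 * (areas p ξ).v2

/-- The projection is the diagram `k2.1_{Bii}`. -/
def BiiDirection (p : Fin 5 → E3) (ξ : E3) : Prop :=
  ((areas p ξ).Cr13 ∧ (areas p ξ).Cr03 ∧ ¬(areas p ξ).Cr02 ∧
    0 < (areas p ξ).t012 * (areas p ξ).t234) ∧ 0 < (areas p ξ).v0 * (areas p ξ).v2

/-- The diagram has the normalized bracket polynomial and the odd writhe of the trivial diagram. -/
def _root_.GaussCode.LooksTrivial (L : GaussCode) : Prop :=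
  L.normalizedBracket = 1 ∧ L.oddWrithe = 0

/-- Here `a` and `b` stand for the volumes and `D` and `E` for the orientations at the two
crossings. As `D` and `E` have opposite signs, equal crossing signs mean that the arc alternates
between top and bottom on the common edge, and opposite signs mean that it does not. -/
theorem looksTrivial_or_k21Diagram {v w : Visit} {a b D E : ℝ}
    (h : (v.label, w.label) ∈ [(4, 9), (9, 10)])
    (hv : v = ⟨v.label, decide (0 < a * D), decide (0 < a)⟩)
    (hw : w = ⟨w.label, decide (0 < b * E), decide (0 < b)⟩)
    (hDE : D * E < 0) :
    (a * b < 0 → (GaussCode.interleaved v w).LooksTrivial) ∧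
    (0 < a * b → ∃ o, GaussCode.interleaved v w =
      GaussCode.k21Diagram v.label w.label o (decide (0 < a))) := by
  constructor
  · intro hab
    have h1 := decide_pos_eq_not hab
    have h2 : decide (0 < b * E) = decide (0 < a * D) := decide_pos_eq (by
      rw [mul_mul_mul_comm]; exact mul_pos_of_neg_of_neg hab hDE)
    rw [hv, hw, h1, h2]
    exact ⟨GaussCode.normalizedBracket_interleaved h _ _,
      GaussCode.oddWrithe_interleaved h _ _⟩
  · intro hab
    have h1 := decide_pos_eq hab
    have h2 : decide (0 < b * E) = !decide (0 < a * D) := decide_pos_eq_not (by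
      rw [mul_mul_mul_comm]; exact mul_neg_of_pos_of_neg hab hDE)
    refine ⟨decide (0 < a * D), ?_⟩
    rw [hv, hw, h1, h2]
    simp [GaussCode.interleaved, GaussCode.k21Diagram, Visit.partner]

/-- The classification of the diagrams by the pairs of edges that cross and, for two crossings, by
their order on the common edge and their signs. The sign of the crossing of $e_1$ and $e_4$ serves
for both kinds of `k2.1`, as both contain it. -/
theorem diagram_cases (hp : IsSimple p) (hξ : IsGeneric p ξ) :
    (BiDirection p ξ ∧ ∃ o, diagram p ξ =
      GaussCode.k21Diagram 4 9 o (decide (0 < vol p 0 1 3 4))) ∨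
    (BiiDirection p ξ ∧ ∃ o, diagram p ξ =
      GaussCode.k21Diagram 9 10 o (decide (0 < vol p 0 1 3 4))) ∨
    (¬BiDirection p ξ ∧ ¬BiiDirection p ξ ∧ (diagram p ξ).LooksTrivial) := by
  have hn := hξ.norm
  by_cases h02 : Crosses p ξ 0 2
  · have c02 := (crosses_zero_two p ξ).1 h02
    have e4 := edgeVol_ne_zero hp (by decide) h02
    have w02 := visit_eq hp (by decide) h02 hn
    rw [edgeVol_zero_two, triple_zero_two] at w02
    rw [edgeVol_zero_two] at e4
    by_cases h13 : Crosses p ξ 1 3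
    · have c13 := (crosses_one_three p ξ).1 h13
      have c03 := c02.cr03 c13
      have h03 := (crosses_zero_three p ξ).2 c03
      have w03 := visit_eq hp (by decide) h03 hn
      have w13 := visit_eq hp (by decide) h13 hn
      have e2 := edgeVol_ne_zero hp (by decide) h03
      have e0 := edgeVol_ne_zero hp (by decide) h13
      rw [edgeVol_zero_three] at w03 e2
      rw [edgeVol_one_three] at w13 e0
      refine .inr (.inr ⟨fun h => h.1.2.2.1 c13, fun h => h.1.2.2.1 c02, ?_⟩)
      rw [diagram_of_all hp hn h02 h13, w02, w03, w13]
      refine ⟨GaussCode.normalizedBracket_interleaved₃ _ _ _ _ _ _ ?_,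
        GaussCode.oddWrithe_interleaved₃ _ _ _ _ _ _⟩
      rintro ⟨s1, s2⟩
      by_cases h4 : 0 < vol p 0 1 2 3
      · have h2 : 0 < vol p 0 1 3 4 := by simpa [h4] using s1
        have h0 : 0 < vol p 1 2 3 4 := by simpa [h2] using s2
        exact OrientedAreas.not_all_pos c02 c13 h0 h2 h4
      · have h2 : ¬0 < vol p 0 1 3 4 := by simpa [h4] using s1
        have h0 : ¬0 < vol p 1 2 3 4 := by simpa [h2] using s2
        exact OrientedAreas.not_all_neg c02 c13 (lt_of_le_of_ne (not_lt.1 h0) e0)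
          (lt_of_le_of_ne (not_lt.1 h2) e2) (lt_of_le_of_ne (not_lt.1 h4) e4)
    · have c13 := (crosses_one_three p ξ).not.1 h13
      by_cases h03 : Crosses p ξ 0 3
      · have c03 := (crosses_zero_three p ξ).1 h03
        have w03 := visit_eq hp (by decide) h03 hn
        have e2 := edgeVol_ne_zero hp (by decide) h03
        rw [edgeVol_zero_three, triple_zero_three] at w03
        rw [edgeVol_zero_three] at e2
        rcases (order_ne_zero hp hξ c03 (.inl c02)).lt_or_gt with hor | hor
        · refine .inr (.inr ⟨fun h => h.1.2.2.2.not_gt hor, fun h => c13 h.1.1, ?_⟩)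
          rw [diagram_of_zero' hp hn h02 h03 h13 hor, w02, w03]
          exact ⟨GaussCode.normalizedBracket_nested (e := (9, 4)) (by simp) _ _ _ _,
            GaussCode.oddWrithe_nested (e := (9, 4)) (by simp) _ _ _ _⟩
        · obtain ⟨k1, k2⟩ := looksTrivial_or_k21Diagram (v := visit p ξ 0 2) (w := visit p ξ 0 3)
            (show (crossingLabel (0 : Fin 4) 2, crossingLabel (0 : Fin 4) 3) ∈ _ by decide)
            w02 w03 (c02.orientation_mul_neg c03)
          rw [← diagram_of_zero hp hn h02 h03 h13 hor] at k1 k2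
          rcases (mul_ne_zero e4 e2).lt_or_gt with h | h
          · exact .inr (.inr ⟨fun h' => h'.2.not_gt h, fun h => c13 h.1.1, k1 h⟩)
          · rw [← decide_pos_eq h] at k2
            exact .inl ⟨⟨⟨c02, c03, c13, hor⟩, h⟩, k2 h⟩
      · have c03 := (crosses_zero_three p ξ).not.1 h03
        refine .inr (.inr ⟨fun h => c03 h.1.2.1, fun h => c03 h.1.2.1, ?_⟩)
        rw [diagram_of_zero_two hp hn h02 h03 h13, w02]
        exact ⟨GaussCode.normalizedBracket_kink (by decide) _ _,
          GaussCode.oddWrithe_kink (by decide) _ _⟩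
  · have c02 := (crosses_zero_two p ξ).not.1 h02
    by_cases h03 : Crosses p ξ 0 3
    · have c03 := (crosses_zero_three p ξ).1 h03
      have w03 := visit_eq hp (by decide) h03 hn
      have e2 := edgeVol_ne_zero hp (by decide) h03
      rw [edgeVol_zero_three, triple_zero_three] at w03
      rw [edgeVol_zero_three] at e2
      by_cases h13 : Crosses p ξ 1 3
      · have c13 := (crosses_one_three p ξ).1 h13
        have w13 := visit_eq hp (by decide) h13 hn
        have e0 := edgeVol_ne_zero hp (by decide) h13
        rw [edgeVol_one_three, triple_one_three] at w13
        rw [edgeVol_one_three] at e0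
        rcases (order_ne_zero hp hξ c03 (.inr c13)).lt_or_gt with hor | hor
        · refine .inr (.inr ⟨fun h => c02 h.1.1, fun h => h.1.2.2.2.not_gt hor, ?_⟩)
          rw [diagram_of_three' hp hn h02 h03 h13 hor, w13, w03]
          exact ⟨GaussCode.normalizedBracket_nested (e := (9, 10)) (by simp) _ _ _ _,
            GaussCode.oddWrithe_nested (e := (9, 10)) (by simp) _ _ _ _⟩
        · obtain ⟨k1, k2⟩ := looksTrivial_or_k21Diagram (v := visit p ξ 0 3) (w := visit p ξ 1 3)
            (show (crossingLabel (0 : Fin 4) 3, crossingLabel (1 : Fin 4) 3) ∈ _ by decide)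
            w03 w13 (c13.orientation_mul_neg c03)
          rw [← diagram_of_three hp hn h02 h03 h13 hor] at k1 k2
          rcases (mul_ne_zero e2 e0).lt_or_gt with h | h
          · exact .inr (.inr ⟨fun h => c02 h.1.1,
              fun h' => h'.2.not_gt (mul_comm _ (vol p 0 1 3 4) ▸ h), k1 h⟩)
          · exact .inr (.inl ⟨⟨⟨c13, c03, c02, hor⟩, mul_comm (vol p 0 1 3 4) _ ▸ h⟩, k2 h⟩)
      · have c13 := (crosses_one_three p ξ).not.1 h13
        refine .inr (.inr ⟨fun h => c02 h.1.1, fun h => c13 h.1.1, ?_⟩)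
        rw [diagram_of_zero_three hp hn h02 h03 h13, w03]
        exact ⟨GaussCode.normalizedBracket_kink (by decide) _ _,
          GaussCode.oddWrithe_kink (by decide) _ _⟩
    · have c03 := (crosses_zero_three p ξ).not.1 h03
      refine .inr (.inr ⟨fun h => c02 h.1.1, fun h => c03 h.1.2.1, ?_⟩)
      by_cases h13 : Crosses p ξ 1 3
      · rw [diagram_of_one_three hp hn h02 h03 h13, visit_eq hp (by decide) h13 hn]
        exact ⟨GaussCode.normalizedBracket_kink (by decide) _ _,
          GaussCode.oddWrithe_kink (by decide) _ _⟩
      · rw [diagram_of_none h02 h03 h13]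
        exact ⟨GaussCode.normalizedBracket_nil, GaussCode.oddWrithe_nil⟩

end diagrams

end Chain

/-! ### The sign of the linking integral -/

theorem intervalIntegral_intervalIntegral_pos {g : ℝ → ℝ → ℝ}
    (hg : ContinuousOn (Function.uncurry g) (Set.Icc 0 1 ×ˢ Set.Icc 0 1))
    (h : ∀ s ∈ Set.Icc (0 : ℝ) 1, ∀ t ∈ Set.Icc (0 : ℝ) 1, 0 < g s t) :
    0 < ∫ s in (0 : ℝ)..1, ∫ t in (0 : ℝ)..1, g s t := by
  -- Clamping the variables to the unit interval extends the integrand to a continuous positive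
  -- function on the plane without changing the integral.
  set c : ℝ → ℝ := fun s => Set.projIcc (0 : ℝ) 1 zero_le_one s with hc
  have hcc : Continuous c := continuous_subtype_val.comp continuous_projIcc
  have hmem : ∀ s, c s ∈ Set.Icc (0 : ℝ) 1 := fun s => Subtype.coe_prop _
  have hce : ∀ s ∈ Set.Icc (0 : ℝ) 1, c s = s := fun s hs => by
    simp [hc, Set.projIcc_of_mem zero_le_one hs]
  have hG : Continuous (Function.uncurry fun s t => g (c s) (c t)) :=
    hg.comp_continuous (f := fun q : ℝ × ℝ => (c q.1, c q.2)) (by fun_prop)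
      fun q => ⟨hmem _, hmem _⟩
  have hF : Continuous fun s => ∫ t in (0 : ℝ)..1, g (c s) (c t) :=
    intervalIntegral.continuous_parametric_intervalIntegral_of_continuous' hG 0 1
  have huI : Set.uIcc (0 : ℝ) 1 = Set.Icc 0 1 := Set.uIcc_of_le zero_le_one
  have e : ∫ s in (0 : ℝ)..1, ∫ t in (0 : ℝ)..1, g s t =
      ∫ s in (0 : ℝ)..1, ∫ t in (0 : ℝ)..1, g (c s) (c t) := by
    refine intervalIntegral.integral_congr fun s hs => ?_
    refine intervalIntegral.integral_congr fun t ht => ?_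
    simp only [hce s (huI ▸ hs), hce t (huI ▸ ht)]
  rw [e]
  refine intervalIntegral.intervalIntegral_pos_of_pos (hF.intervalIntegrable 0 1) (fun s => ?_)
    zero_lt_one
  have hGs : Continuous fun t => g (c s) (c t) :=
    hG.comp (continuous_const.prodMk continuous_id)
  exact intervalIntegral.intervalIntegral_pos_of_pos (hGs.intervalIntegrable 0 1)
    (fun t => h _ (hmem s) _ (hmem t)) zero_lt_one

namespace Chain

theorem edgeSign_eq {p : Fin 5 → E3} (hp : IsSimple p) {i j : Fin 4} (hij : (i : ℕ) + 1 < j) :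
    edgeSign p i j = SignType.sign (edgeVol p i j) := by
  set N : ℝ → ℝ → ℝ := fun s t =>
    ‖(p i.castSucc + s • edge p i) - (p j.castSucc + t • edge p j)‖ ^ 3 with hN
  have hpos : ∀ s ∈ Set.Icc (0 : ℝ) 1, ∀ t ∈ Set.Icc (0 : ℝ) 1, 0 < N s t := by
    intro s hs t ht
    refine pow_pos (norm_pos_iff.2 fun h => ?_) 3
    have h1 : p i.castSucc + s • edge p i ∈ segment ℝ (p i.castSucc) (p i.succ) := by
      rw [segment_eq_image']; exact ⟨s, hs, rfl⟩
    have h2 : p j.castSucc + t • edge p j ∈ segment ℝ (p j.castSucc) (p j.succ) := by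
      rw [segment_eq_image']; exact ⟨t, ht, rfl⟩
    rw [sub_eq_zero.1 h] at h1
    exact Set.disjoint_left.1 (hp.disjoint i j hij) h1 h2
  have hint : 0 < ∫ s in (0 : ℝ)..1, ∫ t in (0 : ℝ)..1, (N s t)⁻¹ := by
    refine intervalIntegral_intervalIntegral_pos ?_ fun s hs t ht => inv_pos.2 (hpos s hs t ht)
    refine ContinuousOn.inv₀ (Continuous.continuousOn ?_) fun q hq =>
      (hpos q.1 hq.1 q.2 hq.2).ne'
    simp only [hN, Function.uncurry_def]
    fun_prop
  have e : linking p i j = edgeVol p i j *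
      (1 / (4 * Real.pi) * ∫ s in (0 : ℝ)..1, ∫ t in (0 : ℝ)..1, (N s t)⁻¹) := by
    -- Moving the two points along their edges adds multiples of the first two arguments, which the
    -- triple product ignores.
    have hnum : ∀ s t : ℝ, triple (edge p i) (edge p j)
        ((p i.castSucc + s • edge p i) - (p j.castSucc + t • edge p j)) = edgeVol p i j := by
      intro s t
      simp only [edgeVol, triple_eq_coords, PiLp.sub_apply, PiLp.add_apply, PiLp.smul_apply,
        smul_eq_mul]
      ring
    simp only [linking, hnum, div_eq_mul_inv (edgeVol p i j),
      intervalIntegral.integral_const_mul]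
    ring
  rw [edgeSign, e, sign_mul, sign_pos (mul_pos (by positivity) hint), mul_one]

/-! ### Reversal of the chain -/

theorem IsSimple.reversed {p : Fin 5 → E3} (hp : IsSimple p) : IsSimple (reversed p) := by
  have hs : ∀ i : Fin 4, segment ℝ (Chain.reversed p i.castSucc) (Chain.reversed p i.succ) =
      segment ℝ (p i.rev.castSucc) (p i.rev.succ) := by
    intro i
    rw [Chain.reversed, Chain.reversed, Fin.rev_castSucc, Fin.rev_succ, segment_symm]
  refine ⟨fun i => ?_, fun i j hij => ?_, fun i j hij => ?_⟩
  · rw [Chain.reversed, Chain.reversed, Fin.rev_castSucc, Fin.rev_succ]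
    exact (hp.edge_ne i.rev).symm
  · rw [hs, hs, Set.inter_comm, hp.consecutive j.rev i.rev (by
      simp only [Fin.val_rev]; omega), Chain.reversed]
    congr 2
    ext
    simp only [Fin.val_rev, Fin.val_castSucc]
    omega
  · rw [hs, hs]
    exact (hp.disjoint j.rev i.rev (by simp only [Fin.val_rev]; omega)).symm

theorem area_reversed (p : Fin 5 → E3) (ξ : E3) (i j k : Fin 5) :
    area (reversed p) ξ i j k = -area p ξ k.rev j.rev i.rev := by
  simp only [area, reversed, triple_sub_coords]; ring

theorem vol_reversed (p : Fin 5 → E3) (i j k l : Fin 5) :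
    vol (reversed p) i j k l = vol p l.rev k.rev j.rev i.rev := by
  simp only [vol, reversed, triple_sub_sub_coords]; ring

/-- Reversal renumbers the vertices, negates all areas and preserves all volumes; only products of
two areas or of two volumes enter. -/
theorem biDirection_reversed (p : Fin 5 → E3) (ξ : E3) :
    BiDirection (reversed p) ξ ↔ BiiDirection p ξ := by
  simp only [BiDirection, BiiDirection, OrientedAreas.Bi, OrientedAreas.Cr02, OrientedAreas.Cr03,
    OrientedAreas.Cr13, areas, area_reversed, vol_reversed, neg_mul_neg]
  simp only [show Fin.rev (0 : Fin 5) = 4 from rfl, show Fin.rev (1 : Fin 5) = 3 from rfl,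
    show Fin.rev (2 : Fin 5) = 2 from rfl, show Fin.rev (3 : Fin 5) = 1 from rfl,
    show Fin.rev (4 : Fin 5) = 0 from rfl]
  constructor <;> rintro ⟨⟨⟨a, b⟩, ⟨c, d⟩, e, f⟩, g⟩ <;>
    exact ⟨⟨⟨by linarith, by linarith⟩, ⟨by linarith, by linarith⟩,
      fun h => e ⟨by linarith [h.2], by linarith [h.1]⟩, by linarith⟩, by linarith⟩

end Chain

/-! ### The directions of the diagram `k2.1_{Bi}` -/

namespace OrientedAreas

variable {C : OrientedAreas}

/-- These are the conditions $w<0$ and $w_0<0$ of the closed form. Viewing from the other side and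
reflecting reduce them to `Bi.signs`. -/
theorem Bi.vol_signs (h : Bi (C := C)) (h42 : 0 < C.v4 * C.v2) :
    C.v2 * C.v3 < 0 ∧ C.v1 * C.v0 < 0 := by
  have key : ∀ D : OrientedAreas, D.Cr02 → Bi (C := D) → 0 < D.v4 → 0 < D.v2 →
      D.v2 * D.v3 < 0 ∧ D.v1 * D.v0 < 0 := by
    intro D hD hB h4 h2
    refine hD.wlog (P := fun E => Bi (C := E) → 0 < E.v4 → 0 < E.v2 →
        E.v2 * E.v3 < 0 ∧ E.v1 * E.v0 < 0) (fun k hB h4 h2 => k (D.bi_neg.2 hB) h4 h2)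
      (fun E _ _ h0 hB h4 h2 => ?_) hB h4 h2
    obtain ⟨s3, s0, s1, -⟩ := hB.signs h0 h4 h2
    exact ⟨mul_neg_of_pos_of_neg h2 s3, mul_neg_of_pos_of_neg s1 s0⟩
  rcases mul_pos_iff.1 h42 with ⟨h4, h2⟩ | ⟨h4, h2⟩
  · exact key C h.1 h h4 h2
  · simpa [mirror] using key C.mirror h.1 h (neg_pos.2 h4) (neg_pos.2 h2)

variable (C) in
/-- The projection of the chain is seen from a direction in the spherical polygon. -/
def InPolygon : Prop := C.t234 ≤ 0 ∧ C.t124 ≤ 0 ∧ C.t014 ≤ 0 ∧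
  (0 ≤ C.v4 * (C.v4 - C.v1) → 0 ≤ C.t023)

theorem inPolygon_neg_of_bi (h : Bi (C := C)) (h0 : 0 < C.t012) (h42 : 0 < C.v4 * C.v2) :
    C.neg.InPolygon := by
  have key : ∀ D : OrientedAreas, Bi (C := D) → 0 < D.t012 → 0 < D.v4 → 0 < D.v2 →
      D.neg.InPolygon := by
    intro D hB h0 h4 h2
    obtain ⟨-, -, -, k1, k2, k3, k4⟩ := hB.signs h0 h4 h2
    simp only [InPolygon, neg]
    exact ⟨by linarith, by linarith, by linarith, fun _ => by linarith⟩
  rcases mul_pos_iff.1 h42 with ⟨h4, h2⟩ | ⟨h4, h2⟩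
  · exact key C h h0 h4 h2
  · have := key C.mirror h h0 (neg_pos.2 h4) (neg_pos.2 h2)
    simp only [InPolygon, neg, mirror] at this ⊢
    refine ⟨this.1, this.2.1, this.2.2.1, fun h => this.2.2.2 (by linarith)⟩

theorem bi_of_inPolygon_neg (h42 : 0 < C.v4 * C.v2) (h23 : C.v2 * C.v3 < 0)
    (h10 : C.v1 * C.v0 < 0) (hx : C.t014 ≠ 0) (hy : C.t124 ≠ 0) (hz : C.t234 ≠ 0)
    (hu : C.t023 ≠ 0) (h : C.neg.InPolygon) : Bi (C := C) := by
  have key : ∀ D : OrientedAreas, 0 < D.v4 → 0 < D.v2 → D.v2 * D.v3 < 0 → D.v1 * D.v0 < 0 →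
      D.t014 ≠ 0 → D.t124 ≠ 0 → D.t234 ≠ 0 → D.t023 ≠ 0 → D.neg.InPolygon → Bi (C := D) := by
    intro D h4 h2 h23 h10 hx hy hz hu h
    have h3 : D.v3 < 0 := neg_of_mul_neg_right h23 h2.le
    -- By `vol`, `v1 - v0 = v2 - v3 + v4`, which is positive here.
    obtain ⟨h0, h1⟩ := neg_pos_of_mul_neg (mul_comm D.v1 _ ▸ h10) (c := D.v2 - D.v3 + D.v4)
      (by linarith) (by linear_combination -D.vol)
    simp only [InPolygon, neg, Left.neg_nonpos_iff, Left.nonneg_neg_iff] at h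
    exact bi_of_signs h4 h2 h3 h0 h1 (lt_of_le_of_ne h.2.2.1 hx.symm)
      (lt_of_le_of_ne h.2.1 hy.symm) (lt_of_le_of_ne h.1 hz.symm) fun hc =>
      lt_of_le_of_ne (h.2.2.2 (mul_nonneg h4.le (sub_nonneg.2 hc))) hu
  rcases mul_pos_iff.1 h42 with ⟨h4, h2⟩ | ⟨h4, h2⟩
  · exact key C h4 h2 h23 h10 hx hy hz hu h
  · refine key C.mirror (neg_pos.2 h4) (neg_pos.2 h2) (by simpa [mirror] using h23)
      (by simpa [mirror] using h10) hx hy hz hu ?_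
    simp only [InPolygon, neg, mirror] at h ⊢
    exact ⟨h.1, h.2.1, h.2.2.1, fun k => h.2.2.2 (by linarith)⟩

/-- The sign of `t012` tells the polygon from its antipode. The areas are assumed nonzero because
the polygon is closed while crossings are strict conditions. -/
theorem bi_iff_inPolygon (h42 : 0 < C.v4 * C.v2) (h23 : C.v2 * C.v3 < 0)
    (h10 : C.v1 * C.v0 < 0) (hx : C.t014 ≠ 0) (hy : C.t124 ≠ 0) (hz : C.t234 ≠ 0)
    (hu : C.t023 ≠ 0) : Bi (C := C) ↔ C.InPolygon ∨ C.neg.InPolygon := by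
  have hnn : C.neg.neg = C := by simp [neg]
  constructor
  · intro h
    rcases h.1.ne_zero.lt_or_gt with h0 | h0
    · left
      rw [← hnn]
      exact inPolygon_neg_of_bi (C := C.neg) (C.bi_neg.2 h) (neg_pos.2 h0) h42
    · exact .inr (inPolygon_neg_of_bi h h0 h42)
  · rintro (h | h)
    · exact C.bi_neg.1 (bi_of_inPolygon_neg (C := C.neg) h42 h23 h10 (neg_ne_zero.2 hx)
        (neg_ne_zero.2 hy) (neg_ne_zero.2 hz) (neg_ne_zero.2 hu) (hnn.symm ▸ h))
    · exact bi_of_inPolygon_neg h42 h23 h10 hx hy hz hu h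

end OrientedAreas

/-! ### The area of the unit sphere -/

section sphere

instance : IsFiniteMeasure sphereArea := inferInstanceAs (IsFiniteMeasure (volume : Measure E3).toSphere)

theorem sphereArea_univ : sphereArea.real Set.univ = 4 * Real.pi := by
  rw [sphereArea, Measure.toSphere_real_apply_univ, Measure.real,
    EuclideanSpace.volume_ball_fin_three]
  simp only [finrank_euclideanSpace, Fintype.card_fin, ENNReal.ofReal_one, one_pow, one_mul,
    ENNReal.toReal_ofReal (show 0 ≤ Real.pi * 4 / 3 by positivity)]
  ring

/-- The area of a set of directions is a multiple of the volume of the cone over it, and here the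
cone lies in a plane. -/
theorem sphereArea_greatCircle {w : E3} (hw : w ≠ 0) :
    sphereArea {x : Sphere2 | ⟪w, (x : E3)⟫ = 0} = 0 := by
  have hm : MeasurableSet {x : Sphere2 | ⟪w, (x : E3)⟫ = 0} :=
    (isClosed_eq (by fun_prop) continuous_const).measurableSet
  rw [sphereArea, Measure.toSphere_apply' _ hm]
  have h0 : (volume : Measure E3) ((ℝ ∙ w)ᗮ : Submodule ℝ E3) = 0 := by
    refine Measure.addHaar_submodule _ _ fun h => hw ?_
    rw [Submodule.orthogonal_eq_top_iff] at h
    exact Submodule.span_singleton_eq_bot.1 h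
  rw [measure_mono_null ?_ h0, mul_zero]
  rintro _ ⟨r, -, _, ⟨x, hx, rfl⟩, rfl⟩
  rw [SetLike.mem_coe, Submodule.mem_orthogonal_singleton_iff_inner_right]
  change ⟪w, (x : E3)⟫ = 0 at hx
  simp [inner_smul_right, hx]

theorem ae_inner_ne_zero {w : E3} (hw : w ≠ 0) :
    ∀ᵐ x : Sphere2 ∂sphereArea, ⟪w, (x : E3)⟫ ≠ 0 := by
  rw [ae_iff]
  simpa using sphereArea_greatCircle hw

open scoped Pointwise in
theorem sphereArea_neg {s : Set Sphere2} (hs : MeasurableSet s) :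
    sphereArea (Neg.neg ⁻¹' s) = sphereArea s := by
  have hs' : MeasurableSet (Neg.neg ⁻¹' s) := (continuous_neg (G := Sphere2)).measurable hs
  rw [sphereArea, Measure.toSphere_apply' _ hs, Measure.toSphere_apply' _ hs',
    ← Measure.measure_neg volume (Set.Ioo (0 : ℝ) 1 • ((↑) '' s : Set E3))]
  congr 2
  ext v
  simp only [Set.mem_neg, Set.mem_smul, Set.mem_image, Set.mem_preimage, exists_exists_and_eq_and]
  constructor
  · rintro ⟨r, hr, x, hx, rfl⟩
    exact ⟨r, hr, -x, hx, by simp⟩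
  · rintro ⟨r, hr, x, hx, h⟩
    exact ⟨r, hr, -x, by simpa using hx, by simpa [neg_eq_iff_eq_neg] using h⟩

theorem directionProb_congr {s t : Set Sphere2}
    (h : ∀ᵐ ξ ∂sphereArea, ξ ∈ s ↔ ξ ∈ t) : directionProb s = directionProb t := by
  rw [directionProb, directionProb, measureReal_congr (Filter.eventuallyEq_set.2 h)]

/-- The area of a set of directions that consists of two antipodal parts. -/
theorem sphereArea_eq_two_mul {s t : Set Sphere2} (ht : MeasurableSet t)
    (h : ∀ᵐ ξ ∂sphereArea, ξ ∈ s ↔ ξ ∈ t ∨ -ξ ∈ t)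
    (h' : ∀ᵐ ξ ∂sphereArea, ¬(ξ ∈ t ∧ -ξ ∈ t)) : sphereArea.real s = 2 * sphereArea.real t := by
  have ht' : MeasurableSet (Neg.neg ⁻¹' t) := (continuous_neg (G := Sphere2)).measurable ht
  rw [measureReal_congr (t := t ∪ Neg.neg ⁻¹' t) (Filter.eventuallyEq_set.2 h), Measure.real,
    measure_union₀ ht'.nullMeasurableSet, sphereArea_neg ht, ← two_mul]
  · simp [Measure.real]
  · rw [AEDisjoint]
    rw [ae_iff] at h'
    simp only [not_not] at h'
    exact h'

end sphere

/-! ### Generic directions and measurability -/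

namespace Chain

theorem continuous_area (p : Fin 5 → E3) (i j k : Fin 5) :
    Continuous fun ξ : Sphere2 => area p (ξ : E3) i j k := by
  unfold area triple
  fun_prop

theorem ae_area_ne_zero {p : Fin 5 → E3} {i j k : Fin 5}
    (h : cross (p j - p i) (p k - p i) ≠ 0) :
    ∀ᵐ ξ : Sphere2 ∂sphereArea, area p (ξ : E3) i j k ≠ 0 := ae_inner_ne_zero h

theorem ae_isGeneric (p : Fin 5 → E3) : ∀ᵐ ξ : Sphere2 ∂sphereArea, IsGeneric p (ξ : E3) := by
  have h1 : ∀ᵐ ξ : Sphere2 ∂sphereArea,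
      cross (p 1 - p 0) (p 2 - p 0) ≠ 0 → area p (ξ : E3) 0 1 2 ≠ 0 := by
    by_cases h : cross (p 1 - p 0) (p 2 - p 0) = 0
    · simp [h]
    · filter_upwards [ae_area_ne_zero h] with ξ hξ _ using hξ
  have h2 : ∀ᵐ ξ : Sphere2 ∂sphereArea,
      cross (p 3 - p 2) (p 4 - p 2) ≠ 0 → area p (ξ : E3) 2 3 4 ≠ 0 := by
    by_cases h : cross (p 3 - p 2) (p 4 - p 2) = 0
    · simp [h]
    · filter_upwards [ae_area_ne_zero h] with ξ hξ _ using hξ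
  filter_upwards [h1, h2] with ξ h1 h2
  exact ⟨by simp [real_inner_self_eq_norm_sq, norm_eq_of_mem_sphere], h1, h2⟩

theorem measurableSet_mul_neg {f g : Sphere2 → ℝ} (hf : Continuous f) (hg : Continuous g) :
    MeasurableSet {ξ | f ξ * g ξ < 0} :=
  (isOpen_lt (hf.mul hg) continuous_const).measurableSet

theorem measurableSet_cr02 (p : Fin 5 → E3) :
    MeasurableSet {ξ : Sphere2 | (areas p (ξ : E3)).Cr02} :=
  (measurableSet_mul_neg (continuous_area p 0 1 2) (continuous_area p 0 1 3)).inter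
    (measurableSet_mul_neg (continuous_area p 0 2 3) (continuous_area p 1 2 3))

theorem measurableSet_cr03 (p : Fin 5 → E3) :
    MeasurableSet {ξ : Sphere2 | (areas p (ξ : E3)).Cr03} :=
  (measurableSet_mul_neg (continuous_area p 0 1 3) (continuous_area p 0 1 4)).inter
    (measurableSet_mul_neg (continuous_area p 0 3 4) (continuous_area p 1 3 4))

theorem measurableSet_cr13 (p : Fin 5 → E3) :
    MeasurableSet {ξ : Sphere2 | (areas p (ξ : E3)).Cr13} :=
  (measurableSet_mul_neg (continuous_area p 1 2 3) (continuous_area p 1 2 4)).inter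
    (measurableSet_mul_neg (continuous_area p 1 3 4) (continuous_area p 2 3 4))

theorem measurableSet_biDirection (p : Fin 5 → E3) :
    MeasurableSet {ξ : Sphere2 | BiDirection p (ξ : E3)} :=
  ((measurableSet_cr02 p).inter ((measurableSet_cr03 p).inter ((measurableSet_cr13 p).compl.inter
    (isOpen_lt continuous_const ((continuous_area p 0 1 2).mul
      (continuous_area p 2 3 4))).measurableSet))).inter 
    (MeasurableSet.const (0 < vol p 0 1 2 3 * vol p 0 1 3 4))

theorem measurableSet_biiDirection (p : Fin 5 → E3) :
    MeasurableSet {ξ : Sphere2 | BiiDirection p (ξ : E3)} := by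
  simpa only [biDirection_reversed] using measurableSet_biDirection (reversed p)

/-! ### The probabilities -/

section probabilities

variable {p : Fin 5 → E3}

theorem not_biDirection_of_bii {ξ : E3} (h : BiiDirection p ξ) : ¬BiDirection p ξ :=
  fun h' => h.1.2.2.1 h'.1.1

theorem _root_.GaussCode.LooksTrivial.not_isK21 {L : GaussCode} (h : L.LooksTrivial) : ¬L.IsK21 :=
  fun h' => h'.oddWrithe_ne_zero h.2

theorem exists_diagram_eq_iff_bi {ξ : E3} (hp : IsSimple p) (hξ : IsGeneric p ξ) :
    (∃ o s : Bool, diagram p ξ = GaussCode.k21Diagram (crossingLabel (0 : Fin 4) 2)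
      (crossingLabel (0 : Fin 4) 3) o s) ↔ BiDirection p ξ := by
  change (∃ o s : Bool, diagram p ξ = GaussCode.k21Diagram 4 9 o s) ↔ _
  rcases diagram_cases hp hξ with ⟨h, o, e⟩ | ⟨h, o, e⟩ | ⟨h, -, e⟩
  · exact ⟨fun _ => h, fun _ => ⟨o, _, e⟩⟩
  · simp [not_biDirection_of_bii h, e, GaussCode.k21Diagram]
  · refine ⟨fun ⟨o, s, h⟩ => ?_, fun h' => (h h').elim⟩
    -- A diagram of this form would be of type `k2.1`, contrary to its vanishing odd writhe.
    exact (GaussCode.LooksTrivial.not_isK21 e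
      (h ▸ GaussCode.isK21_k21Diagram (e := (4, 9)) (by simp) o s)).elim

theorem exists_diagram_eq_iff_bii {ξ : E3} (hp : IsSimple p) (hξ : IsGeneric p ξ) :
    (∃ o s : Bool, diagram p ξ = GaussCode.k21Diagram (crossingLabel (0 : Fin 4) 3)
      (crossingLabel (1 : Fin 4) 3) o s) ↔ BiiDirection p ξ := by
  change (∃ o s : Bool, diagram p ξ = GaussCode.k21Diagram 9 10 o s) ↔ _
  rcases diagram_cases hp hξ with ⟨h, o, e⟩ | ⟨h, o, e⟩ | ⟨-, h, e⟩
  · simp [mt not_biDirection_of_bii (not_not.2 h), e, GaussCode.k21Diagram]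
  · exact ⟨fun _ => h, fun _ => ⟨o, _, e⟩⟩
  · refine ⟨fun ⟨o, s, h⟩ => ?_, fun h' => (h h').elim⟩
    exact (GaussCode.LooksTrivial.not_isK21 e
      (h ▸ GaussCode.isK21_k21Diagram (e := (9, 10)) (by simp) o s)).elim

theorem isK21_diagram_iff {ξ : E3} (hp : IsSimple p) (hξ : IsGeneric p ξ) :
    (diagram p ξ).IsK21 ↔ BiDirection p ξ ∨ BiiDirection p ξ := by
  rcases diagram_cases hp hξ with ⟨h, o, e⟩ | ⟨h, o, e⟩ | ⟨h, h', e⟩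
  · simp [h, e, GaussCode.isK21_k21Diagram (e := (4, 9))]
  · simp [h, e, GaussCode.isK21_k21Diagram (e := (9, 10))]
  · simp [h, h', e.not_isK21]

theorem probBi_eq (hp : IsSimple p) :
    probBi p = directionProb {ξ : Sphere2 | BiDirection p (ξ : E3)} := by
  refine directionProb_congr ?_
  filter_upwards [ae_isGeneric p] with ξ hξ using exists_diagram_eq_iff_bi hp hξ

theorem probBii_eq (hp : IsSimple p) :
    probBii p = directionProb {ξ : Sphere2 | BiiDirection p (ξ : E3)} := by
  refine directionProb_congr ?_
  filter_upwards [ae_isGeneric p] with ξ hξ using exists_diagram_eq_iff_bii hp hξ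

theorem probK21_eq (hp : IsSimple p) : probK21 p =
    directionProb {ξ : Sphere2 | BiDirection p (ξ : E3) ∨ BiiDirection p (ξ : E3)} := by
  refine directionProb_congr ?_
  filter_upwards [ae_isGeneric p] with ξ hξ using isK21_diagram_iff hp hξ

theorem probK21_eq_add (hp : IsSimple p) : probK21 p = probBi p + probBii p := by
  rw [probK21_eq hp, probBi_eq hp, probBii_eq hp, directionProb, directionProb, directionProb,
    ← add_div, Set.ofPred_or, measureReal_union _ (measurableSet_biiDirection p)]
  exact Set.disjoint_left.2 fun ξ h h' => not_biDirection_of_bii h' h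

theorem probBii_eq_probBi_reversed (hp : IsSimple p) : probBii p = probBi (reversed p) := by
  rw [probBii_eq hp, probBi_eq hp.reversed]
  simp only [biDirection_reversed]

end probabilities

end Chain

/-! ### The closed form -/

/-- The three planes in $w$ share the edge `01` and those in $w_0$ the edge `23`. By this identity
each double cross product is a volume times the shared edge vector. -/
theorem cross_cross_cross (a b c : E3) : cross (cross a b) (cross a c) = triple a b c • a := by
  ext k
  fin_cases k <;>
    simp [cross_apply_zero, cross_apply_one, cross_apply_two, triple_eq_coords] <;> ring

namespace Chain

section closedForm

variable {p : Fin 5 → E3}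

/-- The quantities in the closed form in terms of oriented volumes. -/
theorem w_eq : ⟪cross (cross (p 0 - p 4) (p 1 - p 4)) (-cross (p 0 - p 3) (p 1 - p 3)),
    cross (cross (p 0 - p 4) (p 1 - p 4)) (cross (p 1 - p 2) (p 0 - p 2))⟫ =
      ⟪p 1 - p 0, p 1 - p 0⟫ * (vol p 0 1 3 4 * vol p 0 1 2 4) := by
  have h1 : cross (p 0 - p 4) (p 1 - p 4) = cross (p 1 - p 0) (p 4 - p 0) := by
    ext k
    fin_cases k <;> simp [cross_apply_zero, cross_apply_one, cross_apply_two] <;> ring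
  have h2 : -cross (p 0 - p 3) (p 1 - p 3) = cross (p 1 - p 0) (p 0 - p 3) := by
    ext k
    fin_cases k <;> simp [cross_apply_zero, cross_apply_one, cross_apply_two] <;> ring
  have h3 : cross (p 1 - p 2) (p 0 - p 2) = cross (p 1 - p 0) (p 0 - p 2) := by
    ext k
    fin_cases k <;> simp [cross_apply_zero, cross_apply_one, cross_apply_two] <;> ring
  have k1 : triple (p 1 - p 0) (p 4 - p 0) (p 0 - p 3) = vol p 0 1 3 4 := by
    simp only [vol, triple_sub_sub_coords]; ring
  have k2 : triple (p 1 - p 0) (p 4 - p 0) (p 0 - p 2) = vol p 0 1 2 4 := by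
    simp only [vol, triple_sub_sub_coords]; ring
  rw [h1, h2, h3, cross_cross_cross, cross_cross_cross, inner_smul_left, inner_smul_right, k1, k2,
    RCLike.conj_to_real]
  ring

theorem w₀_eq : ⟪cross (cross (p 2 - p 4) (p 2 - p 3)) (-cross (p 0 - p 2) (p 0 - p 3)),
    cross (cross (p 2 - p 4) (p 2 - p 3)) (cross (p 1 - p 3) (p 1 - p 2))⟫ =
      ⟪p 3 - p 2, p 3 - p 2⟫ * (vol p 0 2 3 4 * vol p 1 2 3 4) := by
  have h1 : cross (p 2 - p 4) (p 2 - p 3) = cross (p 3 - p 2) (p 2 - p 4) := by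
    ext k
    fin_cases k <;> simp [cross_apply_zero, cross_apply_one, cross_apply_two] <;> ring
  have h2 : -cross (p 0 - p 2) (p 0 - p 3) = cross (p 3 - p 2) (p 2 - p 0) := by
    ext k
    fin_cases k <;> simp [cross_apply_zero, cross_apply_one, cross_apply_two] <;> ring
  have h3 : cross (p 1 - p 3) (p 1 - p 2) = cross (p 3 - p 2) (p 2 - p 1) := by
    ext k
    fin_cases k <;> simp [cross_apply_zero, cross_apply_one, cross_apply_two] <;> ring
  have k1 : triple (p 3 - p 2) (p 2 - p 4) (p 2 - p 0) = -vol p 0 2 3 4 := by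
    simp only [vol, triple_sub_sub_coords]; ring
  have k2 : triple (p 3 - p 2) (p 2 - p 4) (p 2 - p 1) = -vol p 1 2 3 4 := by
    simp only [vol, triple_sub_sub_coords]; ring
  rw [h1, h2, h3, cross_cross_cross, cross_cross_cross, inner_smul_left, inner_smul_right, k1, k2,
    RCLike.conj_to_real]
  ring

/-- Multiplied by the sign of `vol p 0 1 2 3`, this is negative exactly when the premise in
`InPolygon` fails. -/
theorem c_eq : ⟪p 1 - p 4, cross (p 0 - p 2) (p 0 - p 3)⟫ = vol p 0 1 2 3 - vol p 0 2 3 4 := by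
  rw [real_inner_comm]
  change triple _ _ _ = _
  simp only [vol, triple_sub_sub_coords]; ring

theorem mul_sign_neg_iff {a b : ℝ} : b * ((SignType.sign a : ℤ) : ℝ) < 0 ↔ a * b < 0 := by
  rcases lt_trichotomy a 0 with h | rfl | h
  · simp [sign_neg h, mul_neg_iff, h, h.not_gt]
  · simp
  · simp [sign_pos h, mul_neg_iff, h, h.not_gt]

theorem edge_inner_pos (hp : IsSimple p) (i : Fin 4) : 0 < ⟪edge p i, edge p i⟫ := by
  rw [real_inner_self_eq_norm_sq]
  have : edge p i ≠ 0 := sub_ne_zero.2 (hp.edge_ne i).symm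
  positivity

theorem measurableSet_inPolygon (p : Fin 5 → E3) :
    MeasurableSet {ξ : Sphere2 | (areas p (ξ : E3)).InPolygon} := by
  have h (i j k : Fin 5) : MeasurableSet {ξ : Sphere2 | area p (ξ : E3) i j k ≤ 0} :=
    (isClosed_le (continuous_area p i j k) continuous_const).measurableSet
  have h' : MeasurableSet {ξ : Sphere2 | 0 ≤ vol p 0 1 2 3 * (vol p 0 1 2 3 - vol p 0 2 3 4) →
      0 ≤ area p (ξ : E3) 0 2 3} :=
    (MeasurableSet.const _).imp
      (isClosed_le continuous_const (continuous_area p 0 2 3)).measurableSet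
  exact (h 2 3 4).inter ((h 1 2 4).inter ((h 0 1 4).inter h'))

theorem areas_neg (p : Fin 5 → E3) (ξ : E3) : areas p (-ξ) = (areas p ξ).neg := by
  simp [areas, OrientedAreas.neg, area, triple_neg_right]

theorem cross_ne_zero_of_vol {i j k l : Fin 5} (h : vol p i j k l ≠ 0) :
    cross (p j - p i) (p k - p i) ≠ 0 := by
  intro h0
  exact h (by rw [vol, triple, h0, inner_zero_left])

theorem sphereArea_biDirection (h42 : 0 < vol p 0 1 2 3 * vol p 0 1 3 4)
    (h23 : vol p 0 1 3 4 * vol p 0 1 2 4 < 0) (h10 : vol p 0 2 3 4 * vol p 1 2 3 4 < 0) :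
    sphereArea.real {ξ : Sphere2 | BiDirection p (ξ : E3)} =
      2 * sphereArea.real {ξ : Sphere2 | (areas p (ξ : E3)).InPolygon} := by
  have v0 := right_ne_zero_of_mul h10.ne
  have v1 := left_ne_zero_of_mul h10.ne
  have v3 := right_ne_zero_of_mul h23.ne
  -- A tetrahedron of nonzero volume has nondegenerate faces, and the projected area of such a face
  -- vanishes only on a great circle.
  have hx : ∀ᵐ ξ : Sphere2 ∂sphereArea, area p (ξ : E3) 0 1 4 ≠ 0 := by
    refine ae_area_ne_zero (cross_ne_zero_of_vol (l := 2) ?_)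
    simpa (disch := decide) only [vol_swap₃, neg_ne_zero] using v3
  have hy : ∀ᵐ ξ : Sphere2 ∂sphereArea, area p (ξ : E3) 1 2 4 ≠ 0 := by
    refine ae_area_ne_zero (cross_ne_zero_of_vol (l := 3) ?_)
    simpa (disch := decide) only [vol_swap₃, neg_ne_zero] using v0
  have hz : ∀ᵐ ξ : Sphere2 ∂sphereArea, area p (ξ : E3) 2 3 4 ≠ 0 := by
    refine ae_area_ne_zero (cross_ne_zero_of_vol (l := 1) ?_)
    simpa (disch := decide) only [vol_swap₁, vol_swap₂, vol_swap₃, neg_ne_zero] using v0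
  have hu : ∀ᵐ ξ : Sphere2 ∂sphereArea, area p (ξ : E3) 0 2 3 ≠ 0 :=
    ae_area_ne_zero (cross_ne_zero_of_vol (l := 4) v1)
  refine sphereArea_eq_two_mul (measurableSet_inPolygon p) ?_ ?_
  · filter_upwards [hx, hy, hz, hu] with ξ hx hy hz hu
    change BiDirection p ξ ↔ (areas p ξ).InPolygon ∨ (areas p (-ξ : E3)).InPolygon
    rw [areas_neg, ← OrientedAreas.bi_iff_inPolygon (C := areas p ξ) h42 h23 h10 hx hy hz hu]
    exact ⟨And.left, fun h => ⟨h, h42⟩⟩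
  · filter_upwards [hz] with ξ hz
    rintro ⟨h, h'⟩
    change (areas p (-ξ : E3)).InPolygon at h'
    rw [areas_neg] at h'
    have h1 : area p ξ 2 3 4 ≤ 0 := h.1
    have h2 : -area p ξ 2 3 4 ≤ 0 := h'.1
    exact hz (by linarith)

theorem probBi_eq_closedFormBi (hp : IsSimple p) : probBi p = closedFormBi p := by
  have e0 := edge_inner_pos hp 0
  have e2 := edge_inner_pos hp 2
  change 0 < ⟪p 1 - p 0, p 1 - p 0⟫ at e0
  change 0 < ⟪p 3 - p 2, p 3 - p 2⟫ at e2
  rw [probBi_eq hp, closedFormBi]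
  simp only [w_eq, w₀_eq, c_eq, edgeSign_eq hp (i := 0) (j := 2) (by decide),
    edgeSign_eq hp (i := 0) (j := 3) (by decide), edgeVol_zero_two, edgeVol_zero_three,
    mul_nonneg_iff_of_pos_left e0, mul_nonneg_iff_of_pos_left e2, mul_sign_neg_iff]
  split_ifs with h1 h2
  · have : {ξ : Sphere2 | BiDirection p (ξ : E3)} = ∅ := by
      refine Set.eq_empty_of_forall_notMem fun ξ hξ => ?_
      have h42 : 0 < vol p 0 1 2 3 * vol p 0 1 3 4 := hξ.2
      obtain ⟨h23, h10⟩ := hξ.1.vol_signs h42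
      rcases h1 with h1 | h1 | h1
      · refine h1 ?_
        rcases mul_pos_iff.1 h42 with ⟨a, b⟩ | ⟨a, b⟩
        · rw [sign_pos a, sign_pos b]
        · rw [sign_neg a, sign_neg b]
      · exact h1.not_gt h23
      · exact h1.not_gt h10
    simp [directionProb, this]
  all_goals
    simp only [not_or, not_not, not_le] at h1
    obtain ⟨hs, h23, h10⟩ := h1
    have h42 : 0 < vol p 0 1 2 3 * vol p 0 1 3 4 := by
      have hb := left_ne_zero_of_mul h23.ne
      rcases hb.lt_or_gt with hb | hb
      · rw [sign_neg hb, sign_eq_neg_one_iff] at hs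
        exact mul_pos_of_neg_of_neg hs hb
      · rw [sign_pos hb, sign_eq_one_iff] at hs
        exact mul_pos hs hb
    rw [directionProb, sphereArea_biDirection h42 h23 h10, polygonArea]
    rw [show ∀ a b : ℝ, 2 * a / (4 * b) = 1 / (2 * b) * a by intros; field_simp; ring]
    congr 3
    ext ξ
    have h234 : ⟪cross (p 2 - p 4) (p 2 - p 3), (ξ : E3)⟫ = -area p ξ 2 3 4 := by
      change triple _ _ _ = _
      simp only [area, triple_sub_coords]; ring
    have h124 : ⟪cross (p 1 - p 4) (p 2 - p 4), (ξ : E3)⟫ = area p ξ 1 2 4 := by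
      change triple _ _ _ = _
      simp only [area, triple_sub_coords]; ring
    have h014 : ⟪cross (p 0 - p 4) (p 1 - p 4), (ξ : E3)⟫ = area p ξ 0 1 4 := by
      change triple _ _ _ = _
      simp only [area, triple_sub_coords]; ring
    have h023 : ⟪cross (p 0 - p 2) (p 0 - p 3), (ξ : E3)⟫ = area p ξ 0 2 3 := by
      change triple _ _ _ = _
      simp only [area, triple_sub_coords]; ring
    change (areas p ξ).InPolygon ↔ ∀ w ∈ _, _
    simp only [OrientedAreas.InPolygon, List.forall_mem_cons, inner_neg_left, h234, h124, h014,
      h023, areas, List.not_mem_nil, false_imp_iff, implies_true, and_true, Left.nonneg_neg_iff]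
    -- If $c_{4,1}<0$, the premise of the last condition of `InPolygon` is false and the side with
    -- normal `n₁` disappears; otherwise the premise holds and the side is present.
    first
    | simp only [h2.not_ge, false_imp_iff, and_true]
    | simp only [not_lt.1 h2, true_imp_iff]
      tauto

end closedForm

end Chain

/-! ### The normalized bracket polynomial -/

namespace Chain

section bracket

variable {p : Fin 5 → E3}

-- In either `k2.1` case the volume of $e_1$ and $e_4$ is nonzero, so the value -1 or 1 of
-- `edgeSign` matches the sign of the diagram. If `edgeSign` is 0, only the trivial value occurs.
open Classical in
theorem normalizedBracket_diagram {ξ : E3} (hp : IsSimple p) (hξ : IsGeneric p ξ) (o : Bool) :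
    (diagram p ξ).normalizedBracket = if BiDirection p ξ ∨ BiiDirection p ξ then
      GaussCode.negACubed (-2 * (edgeSign p 0 3 : ℤ)) *
        GaussCode.bracket (GaussCode.k21 o (decide (edgeSign p 0 3 = 1))) else 1 := by
  have sgn (h : vol p 0 1 3 4 ≠ 0) : decide (edgeSign p 0 3 = 1) = decide (0 < vol p 0 1 3 4) ∧
      (edgeSign p 0 3 : ℤ) = if decide (0 < vol p 0 1 3 4) then 1 else -1 := by
    rw [edgeSign_eq hp (by decide), edgeVol_zero_three]
    rcases h.lt_or_gt with h | h
    · simp [sign_neg h, h.not_gt]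
    · simp [sign_pos h, h]
  rcases diagram_cases hp hξ with ⟨h, o', e⟩ | ⟨h, o', e⟩ | ⟨h, h', e⟩
  · obtain ⟨s1, s2⟩ := sgn (right_ne_zero_of_mul h.2.ne')
    rw [if_pos (.inl h), e, s1, s2]
    exact GaussCode.normalizedBracket_k21Diagram (e := (4, 9)) (by simp) _ _ _
  · obtain ⟨s1, s2⟩ := sgn (right_ne_zero_of_mul h.2.ne')
    rw [if_pos (.inr h), e, s1, s2]
    exact GaussCode.normalizedBracket_k21Diagram (e := (9, 10)) (by simp) _ _ _
  · rw [if_neg (by tauto), e.1]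

theorem hasNormalizedBracket (hp : IsSimple p) (o : Bool) : HasNormalizedBracket p
    (C (probK21 p) * GaussCode.negACubed (-2 * (edgeSign p 0 3 : ℤ)) *
        GaussCode.bracket (GaussCode.k21 o (decide (edgeSign p 0 3 = 1))) +
      C (1 - probK21 p)) := by
  classical
  intro k
  set Q := GaussCode.negACubed (-2 * (edgeSign p 0 3 : ℤ)) *
    GaussCode.bracket (GaussCode.k21 o (decide (edgeSign p 0 3 = 1)))
  set B := {ξ : Sphere2 | BiDirection p (ξ : E3) ∨ BiiDirection p (ξ : E3)} with hB
  have hBm : MeasurableSet B := (measurableSet_biDirection p).union (measurableSet_biiDirection p)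
  set u : ℝ := (1 : ℝ[T;T⁻¹]).coeff k
  -- Each coefficient is almost everywhere a two-valued function, written as a constant plus an
  -- indicator.
  have hae : (fun ξ : Sphere2 => (diagram p (ξ : E3)).normalizedBracket.coeff k) =ᵐ[sphereArea]
      fun ξ => B.indicator (fun _ => Q.coeff k - u) ξ + u := by
    filter_upwards [ae_isGeneric p] with ξ hξ
    rw [normalizedBracket_diagram hp hξ o]
    by_cases h : ξ ∈ B
    · rw [if_pos (show BiDirection p ξ ∨ BiiDirection p ξ from h), Set.indicator_of_mem h, sub_add_cancel]
    · rw [if_neg (show ¬(BiDirection p ξ ∨ BiiDirection p ξ) from h), Set.indicator_of_notMem h, zero_add]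
  have hi1 : Integrable (B.indicator fun _ => Q.coeff k - u) sphereArea :=
    (integrable_const _).indicator hBm
  have hi2 : Integrable (fun _ : Sphere2 => u) sphereArea := integrable_const _
  refine ⟨(hi1.add hi2).congr hae.symm, ?_⟩
  rw [integral_congr_ae hae, integral_add hi1 hi2, integral_indicator_const _ hBm, integral_const,
    sphereArea_univ, probK21_eq hp, ← hB, directionProb, mul_assoc]
  have hC (a : ℝ) (f : ℝ[T;T⁻¹]) : (C a * f).coeff k = a * f.coeff k := by
    rw [← smul_eq_C_mul]
    rfl
  have h1 : (C (1 - sphereArea.real B / (4 * Real.pi)) : ℝ[T;T⁻¹]).coeff k =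
      (1 - sphereArea.real B / (4 * Real.pi)) * u := by
    rw [← hC, mul_one]
  rw [AddMonoidAlgebra.coeff_add, Finsupp.add_apply, hC, h1, smul_eq_mul, smul_eq_mul]
  have := Real.pi_ne_zero
  field_simp
  ring

end bracket

end Chain

open Chain GaussCode in
theorem mainTheorem12 (p : Fin 5 → E3) (hp : IsSimple p) :
    (∀ o : Bool, HasNormalizedBracket p
      (C (probK21 p) * negACubed (-2 * (edgeSign p 0 3 : ℤ)) *
          bracket (k21 o (decide (edgeSign p 0 3 = 1))) +
        C (1 - probK21 p))) ∧
    (∀ o : Bool, bracket (k21 o true) = T 2 + 1 - T (-4) ∧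
      bracket (k21 o false) = T (-2) + 1 - T 4) ∧
    probK21 p = probBi p + probBii p ∧
    probBi p = closedFormBi p ∧
    probBii p = probBi (reversed p) ∧
    probBii p = closedFormBi (reversed p) := by
  refine ⟨hasNormalizedBracket hp, fun o => ⟨?_, ?_⟩, probK21_eq_add hp,
    probBi_eq_closedFormBi hp, probBii_eq_probBi_reversed hp, ?_⟩
  · exact bracket_k21Diagram_true (e := (0, 1)) (by simp) o
  · exact bracket_k21Diagram_false (e := (0, 1)) (by simp) o
  · rw [probBii_eq_probBi_reversed hp, probBi_eq_closedFormBi hp.reversed]
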